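/- **Setting.** Let $\mathcal X$ be a measurable space (for instance $\mathbb R^p$) and let $\mathcal H$ be a real reproducing kernel Hilbert space of functions on $\mathcal X$ with a jointly measurable kernel $K$ and feature map $\Phi(x)=K(\cdot,x)$. Fix $s\ge 0$ and probability distributions $P^{(0)},\dots,P^{(s)}$ on $\mathcal X$ with $P^{(j)}\ne P^{(j+1)}$ for $0\le j<s$. For each sample size $n$ let $X_1,\dots,X_n$ be independent $\mathcal X$-valued random variables (a triangular array) with change points $0=z_0\le z_1\le\dots\le z_s\le z_{s+1}=n$ (depending on $n$) such that $X_i\sim P^{(j)}$ for $z_j<i\le z_{j+1}$, and assume $(z_{j+1}-z_j)/n\to w_j>0$ for every $0\le j\le s$. Assume that $K(X_i,X_i)$ is bounded: there is a constant $B$ such that, for every $j$, $K(x,x)\le B$ for $P^{(j)}$-almost every $x$. Let $\mu^{(j)}\in\mathcal H$ be the mean element of $\Phi(X)$ for $X\sim P^{(j)}$, i.e. $\langle\mu^{(j)},f\rangle=E\langle\Phi(X),f\rangle$ for all $f\in\mathcal H$. The structural dimension is $q_d=\dim\operatorname{Span}\{\mu^{(i)}-\mu^{(j)}:0\le i,j\le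 s\}$. **Estimator.** Let $\alpha_n$ be integers with $\alpha_n\ge 2$ for all large $n$. Put $r=\lfloor n/\alpha_n\rfloor$, $\mathcal S_m=\{(m-1)\alpha_n+1,\dots,m\alpha_n\}$ for $1\le m<r$, $\mathcal S_r=\{(r-1)\alpha_n+1,\dots,n\}$ and $\hat n_m=|\mathcal S_m|$. Let $G_m$ be the $n\times\hat n_m$ matrix formed by the columns of $I_n$ with index in $\mathcal S_m$, and let $H_m$ be the $n\times\hat n_m$ matrix whose rows with index in $\mathcal S_m$ consist of ones and whose other rows vanish. With $\mathbf 1_{n\times n}$ the all-ones matrix and $\mathbf K=(K(X_i,X_j))_{i,j\le n}$, set $$L=\tfrac1n\big(I_n-\tfrac1n\mathbf 1_{n\times n}\big)\big(I_n-\tfrac1n\mathbf 1_{n\times n}\big)^\top,\qquad U=\sum_{m=1}^r\frac{1}{r(\hat n_m-1)}\big(G_m-\tfrac1{\hat n_m}H_m\big)\big(G_m-\tfrac1{\hat n_m}H_m\big)^\top,\qquad K_n=(L-U)\mathbf K.$$ Let $\hat\lambda_1\ge\dots\ge\hat\lambda_n$ be the (real) eigenvalues of $K_n$, counted with algebraic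 multiplicity. For a threshold $\tau$ with $0<\tau<1$ and a real ridge sequence $c_n$ the thresholding ridge ratio estimator is $$\hat q_d=\max\Big\{1\le k\le n-1:\ \frac{\hat\lambda_{k+1}+c_n}{\hat\lambda_k+c_n}\le\tau\Big\},\qquad \max\emptyset:=0.$$ **Theorem.** Let $\tilde\eta_n=\max\{n^{-1/2},\alpha_n/n\}$. If $c_n\to0$, $\tilde\eta_n\to0$ and $c_n/\tilde\eta_n\to\infty$ as $n\to\infty$, then $\hat q_d$ is consistent: $P(\hat q_d=q_d)\to1$. -/

import Mathlib

open MeasureTheory ProbabilityTheory Filter Topology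
open scoped InnerProductSpace

noncomputable section

namespace CKPCA

/-! ### The kernel, mean elements, and the central distribution deviation subspace -/

section Population

variable {𝓧 : Type*} (H : Type*) [NormedAddCommGroup H] [InnerProductSpace ℝ H] [CompleteSpace H]
  [RKHS ℝ H 𝓧 ℝ]

/-- The canonical feature map `x ↦ Φ(x) = K(·, x)` into the reproducing kernel Hilbert space. -/
def featureMap (x : 𝓧) : H := RKHS.kerFun H x (1 : ℝ)

/-- The scalar reproducing kernel `K(x, y) = ⟨Φ(x), Φ(y)⟩`. -/
def kernelFun (x y : 𝓧) : ℝ := ⟪featureMap H x, featureMap H y⟫_ℝ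

variable [MeasurableSpace 𝓧]

/-- `m` is the mean element of `Φ(X)`, `X ∼ P`: `⟨m, f⟩ = E ⟨Φ(X), f⟩` for all `f` in `H`
(the expectation being well defined). -/
def IsMeanElement (P : Measure 𝓧) (m : H) : Prop :=
  ∀ f : H, Integrable (fun x => ⟪featureMap H x, f⟫_ℝ) P ∧
    ⟪m, f⟫_ℝ = ∫ x, ⟪featureMap H x, f⟫_ℝ ∂P

variable {H} in
/-- There is at most one mean element. -/
theorem IsMeanElement.unique {P : Measure 𝓧} {m m' : H} (h : IsMeanElement H P m)
    (h' : IsMeanElement H P m') : m = m' :=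
  ext_inner_right ℝ fun f => (h f).2.trans (h' f).2.symm

open Classical in
/-- The mean element of `Φ(X)`, `X ∼ P` (with value `0` if there is none). -/
def meanElement (P : Measure 𝓧) : H :=
  if h : ∃ m : H, IsMeanElement H P m then h.choose else 0

/-- The central distribution deviation subspace: the span of the differences of the mean elements
of the `s + 1` segment distributions. -/
def deviationSubspace {s : ℕ} (P : Fin (s + 1) → Measure 𝓧) : Submodule ℝ H :=
  Submodule.span ℝ
    (Set.range fun ij : Fin (s + 1) × Fin (s + 1) => meanElement H (P ij.1) - meanElement H (P ij.2))

/-- The structural dimension `q_d`. -/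
def structuralDim {s : ℕ} (P : Fin (s + 1) → Measure 𝓧) : ℕ :=
  Module.finrank ℝ (deviationSubspace H P)

end Population

/-! ### The sample target matrix `K_n = (L - U) K` -/

/-- The `m`-th block (`m = 0, …, r - 1`, `r = ⌊n / a⌋`) of the observations `0, …, n - 1`:
`a` consecutive indices, except that the last block extends to the end of the sample. -/
def block (n a : ℕ) (m : Fin (n / a)) : Finset (Fin n) :=
  {i | m.val * a ≤ i.val ∧ (i.val < (m.val + 1) * a ∨ m.val + 1 = n / a)}

/-- `G_m`, the columns of the identity matrix with index in the `m`-th block. -/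
def matG (n a : ℕ) (m : Fin (n / a)) : Matrix (Fin n) (block n a m) ℝ :=
  Matrix.of fun i k => if i = k.val then 1 else 0

/-- `H_m`, all of whose entries in the rows of the `m`-th block are `1`, the others being `0`. -/
def matH (n a : ℕ) (m : Fin (n / a)) : Matrix (Fin n) (block n a m) ℝ :=
  Matrix.of fun i _ => if i ∈ block n a m then 1 else 0

/-- `L = (1/n) (I - (1/n) 1) (I - (1/n) 1)ᵀ`, where `1` is the all-ones matrix. -/
def matL (n : ℕ) : Matrix (Fin n) (Fin n) ℝ :=
  let C : Matrix (Fin n) (Fin n) ℝ := 1 - (1 / (n : ℝ)) • Matrix.of fun _ _ => 1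
  (1 / (n : ℝ)) • (C * C.transpose)

/-- `U = ∑ₘ (1 / (r (nₘ - 1))) (G_m - (1/nₘ) H_m) (G_m - (1/nₘ) H_m)ᵀ`, where `nₘ` is the size of
the `m`-th block and `r` the number of blocks. -/
def matU (n a : ℕ) : Matrix (Fin n) (Fin n) ℝ :=
  ∑ m : Fin (n / a),
    let N : ℝ := (block n a m).card
    let C : Matrix (Fin n) (block n a m) ℝ := matG n a m - (1 / N) • matH n a m
    (1 / (((n / a : ℕ) : ℝ) * (N - 1))) • (C * C.transpose)

/-- The `k`-th largest eigenvalue (`k = 1, 2, …`) of a square matrix with real eigenvalues, counted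
with algebraic multiplicity. -/
def eigval {n : ℕ} (A : Matrix (Fin n) (Fin n) ℝ) (k : ℕ) : ℝ :=
  (A.charpoly.roots.sort (· ≥ ·)).getD (k - 1) 0

section Sample

variable {𝓧 : Type*} (H : Type*) [NormedAddCommGroup H] [InnerProductSpace ℝ H] [CompleteSpace H]
  [RKHS ℝ H 𝓧 ℝ]

/-- The kernel matrix `K` of a sample. -/
def gram {n : ℕ} (x : Fin n → 𝓧) : Matrix (Fin n) (Fin n) ℝ :=
  Matrix.of fun i j => kernelFun H (x i) (x j)

/-- The target matrix `K_n = (L - U) K`. -/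
def targetMatrix {n : ℕ} (a : ℕ) (x : Fin n → 𝓧) : Matrix (Fin n) (Fin n) ℝ :=
  (matL n - matU n a) * gram H x

/-- The ridge ratio `r̂_k = (λ̂_{k+1} + c) / (λ̂_k + c)`. -/
def ridgeRatio {n : ℕ} (a : ℕ) (c : ℝ) (x : Fin n → 𝓧) (k : ℕ) : ℝ :=
  (eigval (targetMatrix H a x) (k + 1) + c) / (eigval (targetMatrix H a x) k + c)

/-- The thresholding ridge ratio estimator: the largest `k` with `1 ≤ k ≤ n - 1` and `r̂_k ≤ τ`,
and `0` if there is none. -/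
def qHat {n : ℕ} (a : ℕ) (c τ : ℝ) (x : Fin n → 𝓧) : ℕ :=
  ((Finset.Icc 1 (n - 1)).filter fun k => ridgeRatio H a c x k ≤ τ).sup id

end Sample

/-- `η̃_n = max {√(1/n), α_n / n}`. -/
def etaTilde (α : ℕ → ℕ) (n : ℕ) : ℝ := max (Real.sqrt (1 / (n : ℝ))) ((α n : ℝ) / (n : ℝ))

end CKPCA

end

noncomputable section

namespace CKPCA

/-! ### Variational bounds for eigenvalues -/

section Spectral

variable {E : Type*} [NormedAddCommGroup E] [InnerProductSpace ℝ E] [FiniteDimensional ℝ E]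

/-! Write `M = L - U`, let `D` be the deviation subspace and `q` its dimension. The eigenvalues of
`M` times the Gram matrix are governed by the form `Q f = ∑ M i j ⟨φ i, f⟩ ⟨φ j, f⟩` on `H`
(`exists_symmetric_representation`). So it suffices to compare `Q`, uniformly in `f`, with its
between-segment part, the sample variance of the numbers `⟨μ (seg i), f⟩`. That part vanishes on
`Dᗮ` and is at least `2δ‖f‖²` on `D`, because no segment has negligible relative length.

The error is estimated in `abs_quadForm_sub_le`. With `e i = φ i - μ (seg i)`, both `L` and `U`
contain a weighted sum of the squares `⟨e i, f⟩²`, and the two weights agree up to a total of order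
`α/n`. The within-segment covariance thus cancels deterministically and need not be estimated. Only
boundedly many blocks meet a change point, each contributing order `α/n`. What remains is random:
averages of `e i` over segments, and one off-diagonal element of `H ⊗ H`. Both are combinations of
pairwise orthogonal terms, so Chebyshev's inequality makes them of order `n^(-1/2)`.

As `c_n` dominates `max {n^(-1/2), α_n/n}`, the error is at most `ε c_n ‖f‖²` with high probability.
Min-max then gives `q` eigenvalues above `δ` and all others in `[-ε c_n, ε c_n]`. The ridge ratio at
`q` is at most `(1 + ε) c_n / δ`, which is small, while beyond `q` it is at least `(1 - ε)/(1 + ε) >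
τ` (`qHat_eq_of_eigval`). Everything is assembled in `measure_qHat_ne_le`. -/

theorem exists_ne_zero_mem_of_finrank_lt (U V : Submodule ℝ E)
    (h : Module.finrank ℝ E < Module.finrank ℝ U + Module.finrank ℝ V) :
    ∃ v : E, v ≠ 0 ∧ v ∈ U ∧ v ∈ V := by
  by_contra! hne
  have hd : Disjoint U V := by
    rw [Submodule.disjoint_def]
    intro x hx hx'
    by_contra h0
    exact hne x h0 hx hx'
  have := Submodule.finrank_add_finrank_le_of_disjoint hd
  omega

variable {n : ℕ} {T : E →ₗ[ℝ] E}

theorem inner_apply_eq_sum_eigenvalues (hT : T.IsSymmetric) (hn : Module.finrank ℝ E = n) (v : E) :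
    ⟪T v, v⟫_ℝ = ∑ i, hT.eigenvalues hn i * ⟪hT.eigenvectorBasis hn i, v⟫_ℝ ^ 2 := by
  rw [← (hT.eigenvectorBasis hn).repr.inner_map_map, PiLp.inner_apply]
  refine Finset.sum_congr rfl fun i _ => ?_
  rw [hT.eigenvectorBasis_apply_self_apply]
  simp [OrthonormalBasis.repr_apply_apply]
  ring

theorem norm_sq_eq_sum_eigenvectorBasis (hT : T.IsSymmetric) (hn : Module.finrank ℝ E = n) (v : E) :
    ‖v‖ ^ 2 = ∑ i, ⟪hT.eigenvectorBasis hn i, v⟫_ℝ ^ 2 :=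
  ((hT.eigenvectorBasis hn).sum_sq_inner_right v).symm

theorem inner_eigenvectorBasis_eq_zero (hT : T.IsSymmetric) (hn : Module.finrank ℝ E = n)
    (s : Set (Fin n)) {v : E} (hv : v ∈ Submodule.span ℝ (hT.eigenvectorBasis hn '' s))
    {i : Fin n} (hi : i ∉ s) : ⟪hT.eigenvectorBasis hn i, v⟫_ℝ = 0 := by
  induction hv using Submodule.span_induction with
  | mem x hx =>
    obtain ⟨j, hj, rfl⟩ := hx
    exact (hT.eigenvectorBasis hn).inner_eq_zero (fun h => hi (h ▸ hj))
  | zero => simp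
  | add x y _ _ hx hy => rw [inner_add_right, hx, hy, add_zero]
  | smul a x _ hx => rw [inner_smul_right, hx, mul_zero]

theorem finrank_span_eigenvectorBasis (hT : T.IsSymmetric) (hn : Module.finrank ℝ E = n)
    (s : Finset (Fin n)) :
    Module.finrank ℝ (Submodule.span ℝ (hT.eigenvectorBasis hn '' (s : Set (Fin n)))) = s.card := by
  classical
  have hli := (hT.eigenvectorBasis hn).toBasis.linearIndependent
  rw [OrthonormalBasis.coe_toBasis] at hli
  have := finrank_span_finset_eq_card (R := ℝ) (s := s.image (hT.eigenvectorBasis hn)) (by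
    have h := (hli.comp (fun i : s => (i : Fin n)) Subtype.val_injective)
    have h2 := h.linearIndepOn_id
    have hr : Set.range (⇑(hT.eigenvectorBasis hn) ∘ fun i : s => (i : Fin n)) =
        ((s.image (hT.eigenvectorBasis hn) : Finset E) : Set E) := by
      ext x; simp
    rw [hr] at h2
    exact h2)
  rw [Finset.coe_image] at this
  rw [this, Finset.card_image_of_injective _ hli.injective]

/-- Lower bound in the min-max principle. -/
theorem le_eigenvalues_of_forall_mem (hT : T.IsSymmetric) (hn : Module.finrank ℝ E = n)
    (W : Submodule ℝ E) (k : Fin n) (hk : k.val < Module.finrank ℝ W) {t : ℝ}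
    (hW : ∀ v ∈ W, t * ‖v‖ ^ 2 ≤ ⟪T v, v⟫_ℝ) : t ≤ hT.eigenvalues hn k := by
  by_contra! hlt
  -- The eigenvectors with zero-based index at least `k` span dimension `n - k`, while `W` has
  -- dimension at least `k + 1`, so the two subspaces meet.
  obtain ⟨v, hv0, hvW, hvs⟩ := exists_ne_zero_mem_of_finrank_lt W
    (Submodule.span ℝ (hT.eigenvectorBasis hn '' ((Finset.Ici k : Finset (Fin n)) : Set (Fin n))))
    (by rw [finrank_span_eigenvectorBasis, Fin.card_Ici]; omega)
  have h1 : ⟪T v, v⟫_ℝ ≤ hT.eigenvalues hn k * ‖v‖ ^ 2 := by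
    rw [inner_apply_eq_sum_eigenvalues hT hn, norm_sq_eq_sum_eigenvectorBasis hT hn, Finset.mul_sum]
    refine Finset.sum_le_sum fun i _ => ?_
    by_cases hi : k ≤ i
    · exact mul_le_mul_of_nonneg_right (hT.eigenvalues_antitone hn hi) (sq_nonneg _)
    · rw [inner_eigenvectorBasis_eq_zero hT hn _ hvs (by simpa using hi)]; simp
  have h2 := hW v hvW
  have h3 : 0 < ‖v‖ ^ 2 := by positivity
  nlinarith

/-- Upper bound in the min-max principle. -/
theorem eigenvalues_le_of_forall_mem (hT : T.IsSymmetric) (hn : Module.finrank ℝ E = n)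
    (W : Submodule ℝ E) (k : Fin n) (hk : n ≤ Module.finrank ℝ W + k.val) {t : ℝ}
    (hW : ∀ v ∈ W, ⟪T v, v⟫_ℝ ≤ t * ‖v‖ ^ 2) : hT.eigenvalues hn k ≤ t := by
  by_contra! hlt
  obtain ⟨v, hv0, hvW, hvs⟩ := exists_ne_zero_mem_of_finrank_lt W
    (Submodule.span ℝ (hT.eigenvectorBasis hn '' ((Finset.Iic k : Finset (Fin n)) : Set (Fin n))))
    (by rw [finrank_span_eigenvectorBasis, Fin.card_Iic]; omega)
  have h1 : hT.eigenvalues hn k * ‖v‖ ^ 2 ≤ ⟪T v, v⟫_ℝ := by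
    rw [inner_apply_eq_sum_eigenvalues hT hn, norm_sq_eq_sum_eigenvectorBasis hT hn, Finset.mul_sum]
    refine Finset.sum_le_sum fun i _ => ?_
    by_cases hi : i ≤ k
    · exact mul_le_mul_of_nonneg_right (hT.eigenvalues_antitone hn hi) (sq_nonneg _)
    · rw [inner_eigenvectorBasis_eq_zero hT hn _ hvs (by simpa using hi)]; simp
  have h2 := hW v hvW
  have h3 : 0 < ‖v‖ ^ 2 := by positivity
  nlinarith

end Spectral

/-! ### Eigenvalues of a symmetric matrix times a Gram matrix -/

theorem eigval_eq_eigenvalues {n : ℕ} {E : Type*} [NormedAddCommGroup E] [InnerProductSpace ℝ E]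
    [FiniteDimensional ℝ E] {T : E →ₗ[ℝ] E} (hT : T.IsSymmetric) (hn : Module.finrank ℝ E = n)
    (A : Matrix (Fin n) (Fin n) ℝ) (hA : A.charpoly = T.charpoly) (k : ℕ) (hk : k - 1 < n) :
    eigval A k = hT.eigenvalues hn ⟨k - 1, hk⟩ := by
  have h := hT.sort_roots_charpoly_eq_eigenvalues hn
  have hre : T.charpoly.roots.map (RCLike.re : ℝ → ℝ) = T.charpoly.roots := by
    simp
  rw [hre] at h
  rw [eigval, hA, h]
  simp [List.getD_eq_getElem?_getD, hk]

section Gram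

variable {H : Type*} [NormedAddCommGroup H] [InnerProductSpace ℝ H]

/-- The quadratic form `f ↦ ∑ M i j ⟨φ i, f⟩ ⟨φ j, f⟩`. -/
def quadForm {n : ℕ} (M : Matrix (Fin n) (Fin n) ℝ) (φ : Fin n → H)
    (f : H) : ℝ :=
  (fun i => ⟪φ i, f⟫_ℝ) ⬝ᵥ M.mulVec (fun i => ⟪φ i, f⟫_ℝ)

/-- A finite family of vectors of a Hilbert space can be represented isometrically in Euclidean
space. -/
theorem exists_euclidean_representation {n : ℕ} (φ : Fin n → H) :
    ∃ (S : H →ₗ[ℝ] EuclideanSpace ℝ (Fin n)) (R : EuclideanSpace ℝ (Fin n) →ₗ[ℝ] H),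
      (∀ f, ‖S f‖ ≤ ‖f‖) ∧ (∀ v, ‖R v‖ ≤ ‖v‖) ∧
      (∀ i f, ⟪S (φ i), S f⟫_ℝ = ⟪φ i, f⟫_ℝ) ∧ (∀ i v, ⟪φ i, R v⟫_ℝ = ⟪S (φ i), v⟫_ℝ) := by
  let V : Submodule ℝ H := Submodule.span ℝ (Set.range φ)
  have : FiniteDimensional ℝ V := FiniteDimensional.span_of_finite ℝ (Set.finite_range φ)
  have hV : Module.finrank ℝ V ≤ n := by
    have h := finrank_range_le_card (R := ℝ) φ
    rwa [Fintype.card_fin] at h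
  obtain ⟨ι⟩ : Nonempty (V →ₗᵢ[ℝ] EuclideanSpace ℝ (Fin n)) := by
    let b := stdOrthonormalBasis ℝ V
    let c := EuclideanSpace.basisFun (Fin n) ℝ
    let g : Fin (Module.finrank ℝ V) → EuclideanSpace ℝ (Fin n) := fun i => c (Fin.castLE hV i)
    have hg : Orthonormal ℝ g := c.orthonormal.comp _ (Fin.castLE_injective hV)
    refine ⟨(b.toBasis.constr ℝ g).isometryOfOrthonormal (v := b.toBasis) ?_ ?_⟩
    · simp
    · convert hg using 1
      ext i : 1
      simp [Function.comp]
  have hmem : ∀ i, φ i ∈ V := fun i => Submodule.subset_span ⟨i, rfl⟩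
  -- `S` projects onto the span and then embeds it by `ι`; `R` is the adjoint of that map. Both are
  -- contractions, which is all that the eigenvalue bounds use about norms.
  let ι' : EuclideanSpace ℝ (Fin n) →L[ℝ] V := ι.toContinuousLinearMap.adjoint
  have hι' : ∀ v, ‖ι' v‖ ≤ ‖v‖ := fun v => by
    have h1 : ‖ι'‖ ≤ 1 := by
      rw [LinearIsometryEquiv.norm_map]
      exact ι.norm_toContinuousLinearMap_le
    simpa using ι'.le_of_opNorm_le h1 v
  refine ⟨ι.toLinearMap ∘ₗ V.orthogonalProjectionOnto.toLinearMap,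
    V.subtype ∘ₗ ι'.toLinearMap, fun f => ?_, fun v => ?_, fun i f => ?_, fun i v => ?_⟩
  · simpa using V.norm_orthogonalProjectionOnto_apply_le f
  · simpa using hι' v
  · have h1 : V.orthogonalProjectionOnto (φ i) = ⟨φ i, hmem i⟩ :=
      V.orthogonalProjectionOnto_mem_subspace_eq_self ⟨φ i, hmem i⟩
    simp only [LinearMap.comp_apply, LinearIsometry.coe_toLinearMap, ContinuousLinearMap.coe_coe,
      LinearIsometry.inner_map_map, h1]
    exact Submodule.inner_orthogonalProjectionOnto_eq_of_mem_left ⟨φ i, hmem i⟩ f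
  · have h1 : V.orthogonalProjectionOnto (φ i) = ⟨φ i, hmem i⟩ :=
      V.orthogonalProjectionOnto_mem_subspace_eq_self ⟨φ i, hmem i⟩
    simp only [LinearMap.comp_apply, LinearIsometry.coe_toLinearMap, ContinuousLinearMap.coe_coe,
      h1, Submodule.subtype_apply]
    have h2 := ContinuousLinearMap.adjoint_inner_right ι.toContinuousLinearMap
      (⟨φ i, hmem i⟩ : V) v
    rw [Submodule.coe_inner] at h2
    exact h2

variable {n : ℕ} {M : Matrix (Fin n) (Fin n) ℝ}

/-- With `A` the matrix of rows `S (φ i)`, the Gram matrix is `A Aᵀ`, and `M A Aᵀ` has the same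
characteristic polynomial as the symmetric matrix `Aᵀ M A`. Since `A` is square, the polynomials
agree exactly, with no extra power of the variable. In particular the eigenvalues of the
nonsymmetric product are real. -/
theorem exists_symmetric_representation (hM : M.IsSymm) (φ : Fin n → H) :
    ∃ (S : H →ₗ[ℝ] EuclideanSpace ℝ (Fin n)) (R : EuclideanSpace ℝ (Fin n) →ₗ[ℝ] H)
      (T : EuclideanSpace ℝ (Fin n) →ₗ[ℝ] EuclideanSpace ℝ (Fin n)),
      (∀ f, ‖S f‖ ≤ ‖f‖) ∧ (∀ v, ‖R v‖ ≤ ‖v‖) ∧ T.IsSymmetric ∧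
      (M * Matrix.of fun i j => ⟪φ i, φ j⟫_ℝ).charpoly = T.charpoly ∧
      (∀ f, ⟪T (S f), S f⟫_ℝ = quadForm M φ f) ∧ (∀ v, ⟪T v, v⟫_ℝ = quadForm M φ (R v)) := by
  obtain ⟨S, R, hS, hR, hSS, hRS⟩ := exists_euclidean_representation φ
  let A : Matrix (Fin n) (Fin n) ℝ := Matrix.of fun i k => S (φ i) k
  have hAA : (Matrix.of fun i j => ⟪φ i, φ j⟫_ℝ) = A * A.transpose := by
    ext i j
    rw [Matrix.of_apply, ← hSS i (φ j), PiLp.inner_apply]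
    simp [A, Matrix.mul_apply, mul_comm]
  have hAv : ∀ v : EuclideanSpace ℝ (Fin n), A.mulVec v.ofLp = fun i => ⟪S (φ i), v⟫_ℝ := by
    intro v
    ext i
    rw [PiLp.inner_apply]
    simp [A, Matrix.mulVec, dotProduct, mul_comm]
  have hform : ∀ v : EuclideanSpace ℝ (Fin n),
      ⟪(A.transpose * M * A).toEuclideanLin v, v⟫_ℝ =
        (fun i => ⟪S (φ i), v⟫_ℝ) ⬝ᵥ M.mulVec (fun i => ⟪S (φ i), v⟫_ℝ) := by
    intro v
    rw [← hAv v, EuclideanSpace.inner_eq_star_dotProduct]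
    simp only [star_trivial, Matrix.toLpLin_apply]
    rw [← Matrix.mulVec_mulVec, ← Matrix.mulVec_mulVec, Matrix.dotProduct_mulVec,
      Matrix.vecMul_transpose]
  refine ⟨S, R, (A.transpose * M * A).toEuclideanLin, hS, hR, ?_, ?_, ?_, ?_⟩
  · rw [Matrix.isSymmetric_toEuclideanLin_iff, Matrix.IsHermitian, Matrix.conjTranspose_eq_transpose_of_trivial]
    simp [Matrix.transpose_mul, hM.eq, Matrix.mul_assoc]
  · have h1 : ((A.transpose * M * A).toEuclideanLin).charpoly = (A.transpose * M * A).charpoly := by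
      rw [Matrix.toEuclideanLin_eq_toLin_orthonormal, Matrix.charpoly_toLin]
    rw [h1, hAA, ← Matrix.mul_assoc, Matrix.charpoly_mul_comm, ← Matrix.mul_assoc]
  · intro f
    rw [hform, quadForm]
    simp_rw [hSS]
  · intro v
    rw [hform, quadForm]
    simp_rw [hRS]

theorem le_eigval_of_forall_mem (hM : M.IsSymm) (φ : Fin n → H)
    (D : Submodule ℝ H) [FiniteDimensional ℝ D] {k : ℕ} (hk1 : 1 ≤ k)
    (hkD : k ≤ Module.finrank ℝ D) (hkn : k ≤ n) {t : ℝ} (ht : 0 < t)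
    (hD : ∀ f ∈ D, t * ‖f‖ ^ 2 ≤ quadForm M φ f) :
    t ≤ eigval (M * Matrix.of fun i j => ⟪φ i, φ j⟫_ℝ) k := by
  obtain ⟨S, R, T, hS, hR, hT, hchar, hTS, hTR⟩ := exists_symmetric_representation hM φ
  rw [eigval_eq_eigenvalues hT finrank_euclideanSpace_fin _ hchar k (by omega)]
  -- Here `t > 0` matters: if `S f = 0` then the form vanishes at `f`, so the lower bound forces `f
  -- = 0`. Hence the image of `D` keeps its dimension.
  have hinj : Function.Injective (S.domRestrict D) := by
    rw [← LinearMap.ker_eq_bot, LinearMap.ker_eq_bot']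
    intro f hf
    have hf' : S (f : H) = 0 := hf
    have h1 := hD f f.2
    rw [← hTS, hf', inner_zero_right] at h1
    have h2 : ‖(f : H)‖ ^ 2 ≤ 0 := by
      by_contra! h
      nlinarith
    have h3 : ‖(f : H)‖ = 0 := by nlinarith [norm_nonneg (f : H)]
    exact Subtype.ext (norm_eq_zero.mp h3)
  refine le_eigenvalues_of_forall_mem hT _ (LinearMap.range (S.domRestrict D)) _ ?_ ?_
  · rw [LinearMap.finrank_range_of_inj hinj]
    simp only
    omega
  · rintro _ ⟨f, rfl⟩
    rw [LinearMap.domRestrict_apply, hTS]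
    refine le_trans ?_ (hD f f.2)
    gcongr
    exact hS f

/-- The test space is the set of vectors that `R` maps into `Dᗮ`; it is cut out by at most `finrank
D` linear conditions. -/
theorem eigval_le_of_forall_mem_orthogonal (hM : M.IsSymm) (φ : Fin n → H)
    (D : Submodule ℝ H) [FiniteDimensional ℝ D] {k : ℕ}
    (hkD : Module.finrank ℝ D < k) (hkn : k ≤ n) {t : ℝ} (ht : 0 ≤ t)
    (hD : ∀ f ∈ Dᗮ, quadForm M φ f ≤ t * ‖f‖ ^ 2) :
    eigval (M * Matrix.of fun i j => ⟪φ i, φ j⟫_ℝ) k ≤ t := by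
  obtain ⟨S, R, T, hS, hR, hT, hchar, hTS, hTR⟩ := exists_symmetric_representation hM φ
  rw [eigval_eq_eigenvalues hT finrank_euclideanSpace_fin _ hchar k (by omega)]
  refine eigenvalues_le_of_forall_mem hT _
    (LinearMap.ker (D.orthogonalProjectionOnto.toLinearMap ∘ₗ R)) _ ?_ ?_
  · have h1 := LinearMap.finrank_range_add_finrank_ker (D.orthogonalProjectionOnto.toLinearMap ∘ₗ R)
    rw [finrank_euclideanSpace_fin] at h1
    have h2 := Submodule.finrank_le (LinearMap.range (D.orthogonalProjectionOnto.toLinearMap ∘ₗ R))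
    simp only
    omega
  · intro v hv
    have hv' : R v ∈ Dᗮ := by
      rw [← Submodule.orthogonalProjectionOnto_eq_zero_iff]
      simpa using hv
    rw [hTR]
    refine (hD _ hv').trans ?_
    gcongr
    exact hR v

theorem neg_le_eigval_of_forall (hM : M.IsSymm) (φ : Fin n → H)
    {k : ℕ} (hk1 : 1 ≤ k) (hkn : k ≤ n) {t : ℝ} (ht : 0 ≤ t)
    (hD : ∀ f, -t * ‖f‖ ^ 2 ≤ quadForm M φ f) :
    -t ≤ eigval (M * Matrix.of fun i j => ⟪φ i, φ j⟫_ℝ) k := by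
  obtain ⟨S, R, T, hS, hR, hT, hchar, hTS, hTR⟩ := exists_symmetric_representation hM φ
  rw [eigval_eq_eigenvalues hT finrank_euclideanSpace_fin _ hchar k (by omega)]
  refine le_eigenvalues_of_forall_mem hT _ ⊤ _ ?_ ?_
  · rw [finrank_top, finrank_euclideanSpace_fin]
    simp only
    omega
  · intro v _
    rw [hTR]
    refine le_trans ?_ (hD _)
    have := pow_le_pow_left₀ (norm_nonneg _) (hR v) 2
    nlinarith

end Gram

/-! ### Centered sums of squares -/

section CenteredSS

variable {ι : Type*}

/-- The sum of the squared deviations from the mean over `S`. -/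
def centeredSS (S : Finset ι) (v : ι → ℝ) : ℝ :=
  ∑ i ∈ S, (v i - (∑ k ∈ S, v k) / S.card) ^ 2

theorem centeredSS_eq (S : Finset ι) (v : ι → ℝ) :
    centeredSS S v = ∑ i ∈ S, v i ^ 2 - (∑ k ∈ S, v k) ^ 2 / S.card := by
  rcases S.eq_empty_or_nonempty with rfl | hS
  · simp [centeredSS]
  have hc : (S.card : ℝ) ≠ 0 := by exact_mod_cast hS.card_pos.ne'
  simp only [centeredSS, sub_sq, Finset.sum_add_distrib, Finset.sum_sub_distrib, Finset.sum_const,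
    nsmul_eq_mul, ← Finset.sum_mul, ← Finset.mul_sum]
  field_simp
  ring

theorem centeredSS_nonneg (S : Finset ι) (v : ι → ℝ) : 0 ≤ centeredSS S v :=
  Finset.sum_nonneg fun _ _ => sq_nonneg _

theorem centeredSS_le_sum_sq (S : Finset ι) (v : ι → ℝ) : centeredSS S v ≤ ∑ i ∈ S, v i ^ 2 := by
  rw [centeredSS_eq]
  exact sub_le_self _ (by positivity)

theorem centeredSS_congr_add_const {S : Finset ι} {v w : ι → ℝ} (c : ℝ)
    (h : ∀ i ∈ S, v i = w i + c) : centeredSS S v = centeredSS S w := by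
  rcases S.eq_empty_or_nonempty with rfl | hS
  · simp [centeredSS]
  have hc : (S.card : ℝ) ≠ 0 := by exact_mod_cast hS.card_pos.ne'
  have hs : (∑ k ∈ S, v k) / S.card = (∑ k ∈ S, w k) / S.card + c := by
    rw [Finset.sum_congr rfl h, Finset.sum_add_distrib, Finset.sum_const, nsmul_eq_mul]
    field_simp
  refine Finset.sum_congr rfl fun i hi => ?_
  rw [hs, h i hi]
  ring

theorem centeredSS_add (S : Finset ι) (u y : ι → ℝ) :
    centeredSS S (fun i => u i + y i) = centeredSS S u + centeredSS S y +
      2 * ∑ i ∈ S, y i * (u i - (∑ k ∈ S, u k) / S.card) := by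
  simp only [centeredSS_eq, mul_sub, Finset.sum_sub_distrib, Finset.sum_add_distrib, add_sq,
    ← Finset.sum_mul]
  have h : ∑ i ∈ S, 2 * u i * y i = 2 * ∑ i ∈ S, y i * u i := by
    rw [Finset.mul_sum]; exact Finset.sum_congr rfl fun i _ => by ring
  rw [h]
  ring

theorem sum_sq_eq_sum_lt [LinearOrder ι] (S : Finset ι) (y : ι → ℝ) :
    (∑ i ∈ S, y i) ^ 2 =
      ∑ i ∈ S, y i ^ 2 + 2 * ∑ i ∈ S, ∑ j ∈ S, if i < j then y i * y j else 0 := by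
  have h1 : ∀ i ∈ S, ∑ j ∈ S, y i * y j = y i ^ 2 + (∑ j ∈ S, if i < j then y i * y j else 0) +
      ∑ j ∈ S, if j < i then y j * y i else 0 := by
    intro i hi
    have h2 : y i ^ 2 = ∑ j ∈ S, if j = i then y i * y j else 0 := by
      rw [Finset.sum_ite_eq' S i, if_pos hi, sq]
    rw [h2, ← Finset.sum_add_distrib, ← Finset.sum_add_distrib]
    refine Finset.sum_congr rfl fun j _ => ?_
    rcases lt_trichotomy i j with h | h | h
    · simp [h, h.ne', h.not_gt]
    · simp [h]
    · simp [h, h.ne, h.not_gt, mul_comm]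
  rw [sq, Finset.sum_mul_sum, Finset.sum_congr rfl h1, Finset.sum_add_distrib,
    Finset.sum_add_distrib, Finset.sum_comm (s := S) (t := S) (f := fun i j => if j < i then y j * y i else 0)]
  ring

/-- The normalization by `card - 1` makes the diagonal weight exactly `1 / (r * card)`, which can be
matched against the weight `1 / n` coming from `L`. -/
theorem centeredSS_div_eq [LinearOrder ι] {S : Finset ι} (hS : 2 ≤ S.card) (y : ι → ℝ) (r : ℝ) :
    1 / (r * ((S.card : ℝ) - 1)) * centeredSS S y = ∑ i ∈ S, y i ^ 2 / (r * S.card) -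
      ∑ i ∈ S, ∑ j ∈ S, if i < j then 2 / (r * S.card * ((S.card : ℝ) - 1)) * (y i * y j) else 0 := by
  have hc : (2 : ℝ) ≤ S.card := by exact_mod_cast hS
  have hc0 : (S.card : ℝ) ≠ 0 := by linarith
  have hc1 : (S.card : ℝ) - 1 ≠ 0 := by linarith
  have h1 : ∑ i ∈ S, ∑ j ∈ S, (if i < j then
      2 / (r * S.card * ((S.card : ℝ) - 1)) * (y i * y j) else 0) =
      2 / (r * S.card * ((S.card : ℝ) - 1)) * ∑ i ∈ S, ∑ j ∈ S, if i < j then y i * y j else 0 := by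
    simp only [Finset.mul_sum, mul_ite, mul_zero]
  rw [h1, centeredSS_eq, sum_sq_eq_sum_lt, ← Finset.sum_div]
  rcases eq_or_ne r 0 with rfl | hr
  · simp
  field_simp
  ring

end CenteredSS

/-! ### The quadratic forms of `L` and `U` -/

theorem isSymm_matL (n : ℕ) : (matL n).IsSymm := by
  simp [matL, Matrix.IsSymm, Matrix.transpose_mul]

theorem isSymm_matU (n a : ℕ) : (matU n a).IsSymm := by
  simp [matU, Matrix.IsSymm, Matrix.transpose_mul, Matrix.transpose_sum]

theorem dotProduct_mul_transpose_mulVec {m k : Type*} [Fintype m] [Fintype k] (C : Matrix m k ℝ)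
    (v : m → ℝ) : v ⬝ᵥ (C * C.transpose).mulVec v = ∑ j, (∑ i, C i j * v i) ^ 2 := by
  rw [← Matrix.mulVec_mulVec, Matrix.dotProduct_mulVec, ← Matrix.mulVec_transpose]
  simp [dotProduct, Matrix.mulVec, sq]

theorem dotProduct_matL_mulVec (n : ℕ) (v : Fin n → ℝ) :
    v ⬝ᵥ (matL n).mulVec v = 1 / n * centeredSS Finset.univ v := by
  rw [matL, Matrix.smul_mulVec, dotProduct_smul, dotProduct_mul_transpose_mulVec, smul_eq_mul,
    centeredSS]
  congr 1
  refine Finset.sum_congr rfl fun j _ => ?_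
  congr 1
  simp [sub_mul, Finset.sum_sub_distrib, Matrix.one_apply, ← Finset.mul_sum]
  ring

theorem dotProduct_matU_mulVec (n a : ℕ) (v : Fin n → ℝ) :
    v ⬝ᵥ (matU n a).mulVec v = ∑ m : Fin (n / a),
      1 / (((n / a : ℕ) : ℝ) * ((block n a m).card - 1)) * centeredSS (block n a m) v := by
  rw [matU, Matrix.sum_mulVec, dotProduct_sum]
  refine Finset.sum_congr rfl fun m _ => ?_
  rw [Matrix.smul_mulVec, dotProduct_smul, dotProduct_mul_transpose_mulVec, smul_eq_mul,
    centeredSS, ← Finset.sum_coe_sort (block n a m)]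
  congr 1
  refine Finset.sum_congr rfl fun j _ => ?_
  congr 1
  simp [matG, matH, sub_mul, Finset.sum_sub_distrib, ← Finset.mul_sum]
  ring

/-! ### The block partition -/

/-- The block containing an index. -/
def blockOf {n a : ℕ} (hr : 0 < n / a) (i : ℕ) : Fin (n / a) :=
  ⟨min (i / a) (n / a - 1), by omega⟩

theorem blockOf_mono {n a : ℕ} (hr : 0 < n / a) : Monotone (blockOf hr) := by
  intro i j hij
  exact min_le_min (Nat.div_le_div_right hij) le_rfl

theorem mem_block_iff {n a : ℕ} (hr : 0 < n / a) (m : Fin (n / a)) (i : Fin n) :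
    i ∈ block n a m ↔ blockOf hr i = m := by
  have ha : 0 < a := by
    rcases Nat.eq_zero_or_pos a with rfl | h
    · simp at hr
    · exact h
  have h1 : m.val * a ≤ i.val ↔ m.val ≤ i.val / a := (Nat.le_div_iff_mul_le ha).symm
  have h2 : i.val < (m.val + 1) * a ↔ i.val / a < m.val + 1 := (Nat.div_lt_iff_lt_mul ha).symm
  have h3 := m.isLt
  simp only [block, Finset.mem_filter, Finset.mem_univ, true_and, h1, h2, blockOf, Fin.ext_iff]
  omega

theorem block_eq_filter {n a : ℕ} (hr : 0 < n / a) (m : Fin (n / a)) :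
    block n a m = Finset.univ.filter fun i : Fin n => blockOf hr i = m := by
  ext i
  simp [mem_block_iff hr]

theorem le_card_block {n a : ℕ} (m : Fin (n / a)) : a ≤ (block n a m).card := by
  have hle : (m.val + 1) * a ≤ n := (Nat.mul_le_mul_right a m.isLt).trans (Nat.div_mul_le_self n a)
  rw [add_mul, one_mul] at hle
  have hlt : ∀ k : Fin a, m.val * a + k.val < n := fun k => by
    have := k.isLt; omega
  have hsub : Finset.univ.image (fun k : Fin a => (⟨m.val * a + k.val, hlt k⟩ : Fin n)) ⊆
      block n a m := by
    intro i hi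
    simp only [Finset.mem_image, Finset.mem_univ, true_and] at hi
    obtain ⟨k, rfl⟩ := hi
    have := k.isLt
    simp only [block, Finset.mem_filter, Finset.mem_univ, true_and]
    refine ⟨by omega, Or.inl ?_⟩
    rw [add_mul, one_mul]; omega
  have hinj : Function.Injective (fun k : Fin a => (⟨m.val * a + k.val, hlt k⟩ : Fin n)) := by
    intro k l h
    simp only [Fin.mk.injEq] at h; ext; omega
  simpa [Finset.card_image_of_injective _ hinj] using Finset.card_le_card hsub

theorem sum_block {n a : ℕ} (hr : 0 < n / a) {β : Type*} [AddCommMonoid β] (g : Fin n → β) :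
    ∑ m, ∑ i ∈ block n a m, g i = ∑ i, g i := by
  simp_rw [block_eq_filter hr]
  exact Finset.sum_fiberwise _ _ _

theorem sum_card_block {n a : ℕ} (hr : 0 < n / a) : ∑ m, ((block n a m).card : ℝ) = n := by
  have := sum_block hr (fun _ : Fin n => (1 : ℝ))
  simpa using this

section Weights

variable {n a : ℕ}

theorem pos_of_numBlocks_pos (hr : 0 < n / a) : 0 < a ∧ 0 < n := by
  constructor
  · rcases Nat.eq_zero_or_pos a with rfl | h
    · simp at hr
    · exact h
  · rcases Nat.eq_zero_or_pos n with rfl | h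
    · simp at hr
    · exact h

theorem lt_numBlocks_add_one_mul (hr : 0 < n / a) : (n : ℝ) < (((n / a : ℕ) : ℝ) + 1) * a := by
  have h1 : n < a * (n / a + 1) := Nat.lt_mul_div_succ n (pos_of_numBlocks_pos hr).1
  have h2 : (n : ℝ) < a * (((n / a : ℕ) : ℝ) + 1) := by exact_mod_cast h1
  linarith

theorem half_le_numBlocks_mul (hr : 0 < n / a) : (n : ℝ) ≤ 2 * (((n / a : ℕ) : ℝ) * a) := by
  have h1 := lt_numBlocks_add_one_mul hr
  have h2 : (1 : ℝ) ≤ ((n / a : ℕ) : ℝ) := by exact_mod_cast hr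
  have h3 : (0 : ℝ) ≤ a := Nat.cast_nonneg _
  nlinarith

theorem one_div_numBlocks_le (hr : 0 < n / a) : 1 / ((n / a : ℕ) : ℝ) ≤ 2 * (a / n : ℝ) := by
  have hn : (0 : ℝ) < n := by exact_mod_cast (pos_of_numBlocks_pos hr).2
  have h2 : (0 : ℝ) < ((n / a : ℕ) : ℝ) := by exact_mod_cast hr
  rw [← mul_div_assoc, div_le_div_iff₀ h2 hn]
  have := half_le_numBlocks_mul hr
  linarith

/-- The diagonal weights of `L - U`, up to the rank one correction of `L`, are summably small. -/
theorem sum_abs_diagonal_weight_le (hr : 0 < n / a) :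
    ∑ i : Fin n, |1 / (n : ℝ) - 1 / (((n / a : ℕ) : ℝ) * (block n a (blockOf hr i)).card)| ≤
      2 * (a / n : ℝ) := by
  obtain ⟨ha, hn⟩ := pos_of_numBlocks_pos hr
  set r : ℝ := ((n / a : ℕ) : ℝ) with hrdef
  have hr0 : 0 < r := by rw [hrdef]; exact_mod_cast hr
  have hn0 : (0 : ℝ) < n := by exact_mod_cast hn
  have ha0 : (0 : ℝ) < a := by exact_mod_cast ha
  have hlt := lt_numBlocks_add_one_mul hr
  rw [← hrdef] at hlt
  -- A block contributes `|x|` with `x = card / n - 1 / r`, and `x ≥ -h` for `h = a / (r n)`. Hence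
  -- `|x| ≤ x + 2h`. Summed over the blocks, the terms `x` cancel and only `2 r h = 2 a / n` is
  -- left, although the last block may be nearly twice as long as the others.
  have hblock : ∀ m : Fin (n / a), ∑ i ∈ block n a m,
      |1 / (n : ℝ) - 1 / (r * (block n a (blockOf hr i)).card)| ≤
        (((block n a m).card : ℝ) / n - 1 / r) + 2 * (a / (r * n)) := by
    intro m
    have hN : (a : ℝ) ≤ (block n a m).card := by exact_mod_cast le_card_block m
    have hN0 : (0 : ℝ) < (block n a m).card := ha0.trans_le hN
    have h1 : ∑ i ∈ block n a m, |1 / (n : ℝ) - 1 / (r * (block n a (blockOf hr i)).card)| =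
        |((block n a m).card : ℝ) / n - 1 / r| := by
      rw [Finset.sum_congr rfl (g := fun _ => |1 / (n : ℝ) - 1 / (r * (block n a m).card)|)
        (fun i hi => by rw [(mem_block_iff hr m i).1 hi])]
      rw [Finset.sum_const, nsmul_eq_mul]
      nth_rewrite 1 [← abs_of_pos hN0]
      rw [← abs_mul]
      congr 1
      field_simp
    have h2 : -((a : ℝ) / (r * n)) ≤ ((block n a m).card : ℝ) / n - 1 / r := by
      have h3 : (a : ℝ) / n ≤ (block n a m).card / n := by gcongr
      have h4 : 1 / r ≤ a / n + a / (r * n) := by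
        have : (a : ℝ) / n + a / (r * n) = ((r + 1) * a) / (r * n) := by field_simp
        rw [this, div_le_div_iff₀ hr0 (by positivity)]
        nlinarith
      linarith
    have h5 : 0 ≤ (a : ℝ) / (r * n) := by positivity
    rw [h1, abs_le]
    constructor <;> linarith
  rw [← sum_block hr]
  refine (Finset.sum_le_sum fun m _ => hblock m).trans (le_of_eq ?_)
  rw [Finset.sum_add_distrib, Finset.sum_sub_distrib, ← Finset.sum_div, sum_card_block hr]
  simp only [Finset.sum_const, Finset.card_univ, Fintype.card_fin, nsmul_eq_mul, ← hrdef]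
  field_simp
  ring

/-- The weight of the pair `i < j` in the quadratic form of `-U`. -/
def pairWeight (hr : 0 < n / a) (i j : Fin n) : ℝ :=
  if i < j ∧ blockOf hr j = blockOf hr i then
    2 / (((n / a : ℕ) : ℝ) * (block n a (blockOf hr i)).card *
      ((block n a (blockOf hr i)).card - 1)) else 0

theorem dotProduct_matU_mulVec_eq_sum_pairWeight (ha : 2 ≤ a) (hr : 0 < n / a) (y : Fin n → ℝ) :
    y ⬝ᵥ (matU n a).mulVec y =
      ∑ i, y i ^ 2 / (((n / a : ℕ) : ℝ) * (block n a (blockOf hr i)).card) -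
        ∑ i, ∑ j, pairWeight hr i j * (y i * y j) := by
  rw [dotProduct_matU_mulVec, ← sum_block hr, ← sum_block hr, ← Finset.sum_sub_distrib]
  refine Finset.sum_congr rfl fun m _ => ?_
  rw [centeredSS_div_eq (ha.trans (le_card_block m))]
  congr 1
  · refine Finset.sum_congr rfl fun i hi => ?_
    rw [(mem_block_iff hr m i).1 hi]
  · refine Finset.sum_congr rfl fun i hi => ?_
    have hi' := (mem_block_iff hr m i).1 hi
    nth_rewrite 1 [block_eq_filter hr m]
    rw [Finset.sum_filter]
    refine Finset.sum_congr rfl fun j _ => ?_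
    rw [pairWeight, hi']
    by_cases h1 : i < j <;> by_cases h2 : blockOf hr (j : ℕ) = m <;> simp [h1, h2]

/-- A block of size `N` has at most `N²` pairs of weight of order `1 / (r N²)`, and so contributes
order `1 / (r N)²`. Over `r` blocks this gives order `1 / (r a²)`, which is at most of order `1 / (r
a)`, hence of order `1 / n`, whatever the block length. -/
theorem sum_pairWeight_sq_le (ha : 2 ≤ a) (hr : 0 < n / a) :
    ∑ i, ∑ j, pairWeight hr i j ^ 2 ≤ 16 / n := by
  have hn0 : (0 : ℝ) < n := by exact_mod_cast (pos_of_numBlocks_pos hr).2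
  set r : ℝ := ((n / a : ℕ) : ℝ) with hrdef
  have hr0 : 0 < r := by rw [hrdef]; exact_mod_cast hr
  have ha0 : (2 : ℝ) ≤ a := by exact_mod_cast ha
  have hblock : ∀ m : Fin (n / a), ∑ i ∈ block n a m, ∑ j, pairWeight hr i j ^ 2 ≤
      8 / (r ^ 2 * a) := by
    intro m
    set N : ℝ := ((block n a m).card : ℝ) with hNdef
    have hN : (a : ℝ) ≤ N := by rw [hNdef]; exact_mod_cast le_card_block m
    have h1 : ∀ i ∈ block n a m, ∑ j, pairWeight hr i j ^ 2 ≤ N * (2 / (r * N * (N - 1))) ^ 2 := by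
      intro i hi
      have hi' := (mem_block_iff hr m i).1 hi
      calc ∑ j, pairWeight hr i j ^ 2
          ≤ ∑ j : Fin n, (if blockOf hr (j : ℕ) = m then (2 / (r * N * (N - 1))) ^ 2 else 0) := by
            refine Finset.sum_le_sum fun j _ => ?_
            rw [pairWeight, hi']
            by_cases h1 : i < j <;> by_cases h2 : blockOf hr (j : ℕ) = m <;>
              simp only [h1, h2, true_and, false_and, and_false, if_true, if_false, le_refl,
                ne_eq, OfNat.ofNat_ne_zero, not_false_eq_true, zero_pow] <;>
              first | exact le_rfl | positivity
        _ = N * (2 / (r * N * (N - 1))) ^ 2 := by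
            rw [← Finset.sum_filter, Finset.sum_const, ← block_eq_filter hr, nsmul_eq_mul]
    refine (Finset.sum_le_sum h1).trans ?_
    rw [Finset.sum_const, nsmul_eq_mul, ← hNdef]
    have hN1 : 0 < N - 1 := by linarith
    have hN0 : 0 < N := by linarith
    have h2 : N * (N * (2 / (r * N * (N - 1))) ^ 2) = 4 / (r ^ 2 * (N - 1) ^ 2) := by
      field_simp
      ring
    rw [h2, div_le_div_iff₀ (by positivity) (by positivity)]
    have h3 : a ≤ 2 * (N - 1) ^ 2 := by nlinarith
    nlinarith [mul_le_mul_of_nonneg_left h3 (sq_nonneg r)]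
  rw [← sum_block hr]
  refine (Finset.sum_le_sum fun m _ => hblock m).trans ?_
  rw [Finset.sum_const, Finset.card_univ, Fintype.card_fin, nsmul_eq_mul, ← hrdef]
  have h1 : r * (8 / (r ^ 2 * a)) = 8 / (r * a) := by field_simp
  rw [h1, div_le_div_iff₀ (by positivity) hn0]
  have := half_le_numBlocks_mul hr
  rw [← hrdef] at this
  linarith

end Weights

/-! ### The quadratic form of the target matrix -/

section Decomposition

open scoped TensorProduct

variable {H : Type*} [NormedAddCommGroup H] [InnerProductSpace ℝ H] {n a : ℕ}

/-- The off-diagonal part of the pooled within-block covariance. -/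
def offDiagonal (hr : 0 < n / a) (e : Fin n → H) : H ⊗[ℝ] H :=
  ∑ p : Fin n × Fin n, pairWeight hr p.1 p.2 • (e p.1 ⊗ₜ[ℝ] e p.2)

theorem abs_sum_mul_inner_le_norm {κ V : Type*} [NormedAddCommGroup V] [InnerProductSpace ℝ V]
    (S : Finset κ) (β : κ → ℝ) (ψ : κ → V) (g : V) :
    |∑ p ∈ S, β p * ⟪ψ p, g⟫_ℝ| ≤ ‖∑ p ∈ S, β p • ψ p‖ * ‖g‖ := by
  have h1 : ∑ p ∈ S, β p * ⟪ψ p, g⟫_ℝ = ⟪∑ p ∈ S, β p • ψ p, g⟫_ℝ := by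
    rw [sum_inner]
    exact Finset.sum_congr rfl fun p _ => (real_inner_smul_left _ _ _).symm
  rw [h1]
  exact abs_real_inner_le_norm _ _

/-- The left side is the inner product of the off-diagonal tensor with `f ⊗ f`, whose norm is
`‖f‖²`. One random norm thereby controls all `f` at once. -/
theorem abs_sum_pairWeight_le (hr : 0 < n / a) (e : Fin n → H) (f : H) :
    |∑ i, ∑ j, pairWeight hr i j * (⟪e i, f⟫_ℝ * ⟪e j, f⟫_ℝ)| ≤ ‖offDiagonal hr e‖ * ‖f‖ ^ 2 := by
  rw [sq, ← TensorProduct.norm_tmul (𝕜 := ℝ) f f, ← Fintype.sum_prod_type']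
  exact abs_sum_mul_inner_le_norm Finset.univ (fun p : Fin n × Fin n => pairWeight hr p.1 p.2)
    (fun p => e p.1 ⊗ₜ[ℝ] e p.2) (f ⊗ₜ[ℝ] f)

theorem sq_inner_le {x f : H} {b : ℝ} (h : ‖x‖ ≤ b) : ⟪x, f⟫_ℝ ^ 2 ≤ b ^ 2 * ‖f‖ ^ 2 := by
  rw [← mul_pow, ← sq_abs]
  gcongr
  exact (abs_real_inner_le_norm _ _).trans (by gcongr)

theorem centeredSS_block_div_le (ha : 2 ≤ a) (m : Fin (n / a)) {v : Fin n → ℝ} {C : ℝ}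
    (hv : ∀ i, v i ^ 2 ≤ C) :
    1 / (((n / a : ℕ) : ℝ) * ((block n a m).card - 1)) * centeredSS (block n a m) v ≤
      2 * C * (1 / ((n / a : ℕ) : ℝ)) := by
  have hr0 : (0 : ℝ) < ((n / a : ℕ) : ℝ) := by
    have : 0 < n / a := (Nat.zero_le _).trans_lt m.isLt
    exact_mod_cast this
  have hN : (2 : ℝ) ≤ (block n a m).card := by exact_mod_cast ha.trans (le_card_block m)
  set N : ℝ := ((block n a m).card : ℝ)
  have h1 : centeredSS (block n a m) v ≤ N * C := by
    refine (centeredSS_le_sum_sq _ _).trans ?_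
    refine (Finset.sum_le_sum fun i _ => hv i).trans ?_
    rw [Finset.sum_const, nsmul_eq_mul]
  have hC : 0 ≤ C := by
    obtain ⟨i, hi⟩ : (block n a m).Nonempty := by
      rw [← Finset.card_pos]
      exact lt_of_lt_of_le (by omega) (ha.trans (le_card_block m))
    exact (sq_nonneg _).trans (hv i)
  have hN1 : 0 < N - 1 := by linarith
  calc 1 / (((n / a : ℕ) : ℝ) * (N - 1)) * centeredSS (block n a m) v
      ≤ 1 / (((n / a : ℕ) : ℝ) * (N - 1)) * (N * C) := by gcongr
    _ ≤ 2 * C * (1 / ((n / a : ℕ) : ℝ)) := by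
        have h2 : 1 / (((n / a : ℕ) : ℝ) * (N - 1)) * (N * C) =
            (N / (N - 1)) * C * (1 / ((n / a : ℕ) : ℝ)) := by field_simp
        rw [h2]
        gcongr
        rw [div_le_iff₀ hN1]
        linarith

/-- On a block where `u` is constant, centering removes `u`, so `x` and `y` contribute equally. On
any other block both contributions lie between `0` and `2C / r`. -/
theorem abs_sub_dotProduct_matU_le (ha : 2 ≤ a) {x u y : Fin n → ℝ} (hxy : ∀ i, x i = u i + y i)
    {C : ℝ} (hx : ∀ i, x i ^ 2 ≤ C) (hy : ∀ i, y i ^ 2 ≤ C) (bad : Finset (Fin (n / a)))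
    (hbad : ∀ m ∉ bad, ∀ i ∈ block n a m, ∀ k ∈ block n a m, u i = u k) :
    |x ⬝ᵥ (matU n a).mulVec x - y ⬝ᵥ (matU n a).mulVec y| ≤
      bad.card * (2 * C * (1 / ((n / a : ℕ) : ℝ))) := by
  rw [dotProduct_matU_mulVec, dotProduct_matU_mulVec, ← Finset.sum_sub_distrib]
  refine (Finset.abs_sum_le_sum_abs _ _).trans ?_
  rw [← nsmul_eq_mul, ← Finset.sum_const,
    ← Finset.sum_subset (Finset.subset_univ bad)]
  · refine Finset.sum_le_sum fun m _ => ?_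
    have hN : (2 : ℝ) ≤ (block n a m).card := by exact_mod_cast ha.trans (le_card_block m)
    have hpos : ∀ v : Fin n → ℝ, 0 ≤ 1 / (((n / a : ℕ) : ℝ) * ((block n a m).card - 1)) *
        centeredSS (block n a m) v := fun v =>
      mul_nonneg (one_div_nonneg.2 (mul_nonneg (Nat.cast_nonneg _) (by linarith)))
        (centeredSS_nonneg _ _)
    exact abs_sub_le_of_nonneg_of_le (hpos x) (centeredSS_block_div_le ha m hx) (hpos y)
      (centeredSS_block_div_le ha m hy)
  · intro m _ hm
    obtain ⟨k, hk⟩ : (block n a m).Nonempty := by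
      rw [← Finset.card_pos]
      exact lt_of_lt_of_le (by omega) (ha.trans (le_card_block m))
    rw [centeredSS_congr_add_const (u k) (v := x) (w := y), sub_self, abs_zero]
    intro i hi
    rw [hxy i, hbad m hm i hi k hk, add_comm]

/-- The average over a segment, relative to the whole sample. -/
def segmentMean {ι : Type*} [DecidableEq ι] (seg : Fin n → ι) (e : Fin n → H) (j : ι) : H :=
  (1 / (n : ℝ)) • ∑ i with seg i = j, e i

theorem sum_mul_inner_eq {ι : Type*} [Fintype ι] [DecidableEq ι] (seg : Fin n → ι) (e : Fin n → H)
    (g : ι → ℝ) (f : H) :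
    1 / (n : ℝ) * ∑ i, ⟪e i, f⟫_ℝ * g (seg i) = ∑ j, ⟪segmentMean seg e j, f⟫_ℝ * g j := by
  rw [← Finset.sum_fiberwise Finset.univ seg, Finset.mul_sum]
  refine Finset.sum_congr rfl fun j _ => ?_
  rw [segmentMean, real_inner_smul_left, sum_inner, mul_assoc, Finset.sum_mul]
  congr 1
  refine Finset.sum_congr rfl fun i hi => ?_
  rw [(Finset.mem_filter.1 hi).2]

theorem abs_sum_mul_inner_le {ι : Type*} [Fintype ι] [DecidableEq ι] (seg : Fin n → ι)
    (e : Fin n → H) (g : ι → ℝ) (f : H) {C : ℝ} (hg : ∀ j, |g j| ≤ C) :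
    |1 / (n : ℝ) * ∑ i, ⟪e i, f⟫_ℝ * g (seg i)| ≤ (∑ j, ‖segmentMean seg e j‖) * ‖f‖ * C := by
  rw [sum_mul_inner_eq, Finset.sum_mul, Finset.sum_mul]
  refine (Finset.abs_sum_le_sum_abs _ _).trans (Finset.sum_le_sum fun j _ => ?_)
  rw [abs_mul]
  have := abs_real_inner_le_norm (segmentMean seg e j) f
  have h0 := hg j
  gcongr

theorem abs_average_le {v : Fin n → ℝ} {C : ℝ} (hC : 0 ≤ C) (hv : ∀ i, |v i| ≤ C) :
    |(∑ i, v i) / n| ≤ C := by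
  rcases Nat.eq_zero_or_pos n with rfl | hn
  · simpa using hC
  have hn0 : (0 : ℝ) < n := by exact_mod_cast hn
  rw [abs_div, abs_of_pos hn0, div_le_iff₀ hn0]
  refine (Finset.abs_sum_le_sum_abs _ _).trans ((Finset.sum_le_sum fun i _ => hv i).trans ?_)
  simp [mul_comm]

/-- The quadratic form of the target matrix differs from the between-segment quadratic form by
averages of centered features over segments, the off-diagonal within-block term, and a remainder
of the order of the relative block length. -/
theorem abs_quadForm_sub_le {ι : Type*} [Fintype ι] [DecidableEq ι] (ha : 2 ≤ a) (hr : 0 < n / a)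
    (φ : Fin n → H) (seg : Fin n → ι) (μ : ι → H) {b : ℝ} (hφ : ∀ i, ‖φ i‖ ≤ b)
    (hμ : ∀ j, ‖μ j‖ ≤ b) (bad : Finset (Fin (n / a)))
    (hbad : ∀ m ∉ bad, ∀ i ∈ block n a m, ∀ k ∈ block n a m, seg i = seg k) (f : H) :
    |quadForm (matL n - matU n a) φ f -
        1 / n * centeredSS Finset.univ (fun i => ⟪μ (seg i), f⟫_ℝ)| ≤
      (6 * b * ∑ j, ‖segmentMean seg (fun i => φ i - μ (seg i)) j‖ +
        ‖offDiagonal hr (fun i => φ i - μ (seg i))‖ + (8 + 16 * bad.card) * b ^ 2 * (a / n)) *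
          ‖f‖ ^ 2 := by
  obtain ⟨ha0, hn⟩ := pos_of_numBlocks_pos hr
  have hn0 : (0 : ℝ) < n := by exact_mod_cast hn
  have hb : 0 ≤ b := (norm_nonneg _).trans (hφ ⟨0, hn⟩)
  set e : Fin n → H := fun i => φ i - μ (seg i) with he
  have heb : ∀ i, ‖e i‖ ≤ 2 * b := fun i => by
    have := norm_sub_le (φ i) (μ (seg i)); have := hφ i; have := hμ (seg i); simp only [he]; linarith
  set x : Fin n → ℝ := fun i => ⟪φ i, f⟫_ℝ with hx
  set u : Fin n → ℝ := fun i => ⟪μ (seg i), f⟫_ℝ with hu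
  set y : Fin n → ℝ := fun i => ⟪e i, f⟫_ℝ with hy
  have hxy : ∀ i, x i = u i + y i := fun i => by simp [hx, hu, hy, he, inner_sub_left]
  set A := ∑ j, ‖segmentMean seg e j‖ with hA
  have hA0 : 0 ≤ A := Finset.sum_nonneg fun _ _ => norm_nonneg _
  have hub : ∀ j, |⟪μ j, f⟫_ℝ| ≤ b * ‖f‖ := fun j =>
    (abs_real_inner_le_norm _ _).trans (by gcongr; exact hμ j)
  have hubar : |(∑ k, u k) / n| ≤ b * ‖f‖ := abs_average_le (by positivity) fun i => hub _
  -- the cross term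
  have hcross : |1 / (n : ℝ) * ∑ i, y i * (u i - (∑ k, u k) / n)| ≤ A * ‖f‖ * (2 * (b * ‖f‖)) := by
    refine abs_sum_mul_inner_le seg e (fun j => ⟪μ j, f⟫_ℝ - (∑ k, u k) / n) f fun j => ?_
    refine (abs_sub _ _).trans ?_
    linarith [hub j]
  -- the squared overall mean
  have hmean : |(∑ i, y i) / n| ≤ A * ‖f‖ := by
    have := abs_sum_mul_inner_le seg e (fun _ => 1) f (C := 1) (by simp)
    simp only [mul_one, one_div, inv_mul_eq_div] at this
    exact this
  have hmean' : |(∑ i, y i) / n| ≤ 2 * b * ‖f‖ := abs_average_le (by positivity) fun i =>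
    (abs_real_inner_le_norm _ _).trans (by gcongr; exact heb i)
  have hmeansq : ((∑ i, y i) / n) ^ 2 ≤ 2 * b * A * ‖f‖ ^ 2 := by
    rw [← sq_abs, sq]
    calc |(∑ i, y i) / n| * |(∑ i, y i) / n| ≤ (A * ‖f‖) * (2 * b * ‖f‖) := by gcongr
      _ = _ := by ring
  -- the diagonal
  have hysq : ∀ i, y i ^ 2 ≤ (2 * b) ^ 2 * ‖f‖ ^ 2 := fun i => sq_inner_le (heb i)
  have hdiag : |∑ i : Fin n, (1 / (n : ℝ) - 1 / (((n / a : ℕ) : ℝ) * (block n a (blockOf hr i)).card)) *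
      y i ^ 2| ≤ 2 * (a / n) * ((2 * b) ^ 2 * ‖f‖ ^ 2) := by
    refine (Finset.abs_sum_le_sum_abs _ _).trans ?_
    refine le_trans ?_ (mul_le_mul_of_nonneg_right (sum_abs_diagonal_weight_le hr) (by positivity))
    rw [Finset.sum_mul]
    refine Finset.sum_le_sum fun i _ => ?_
    rw [abs_mul, abs_of_nonneg (sq_nonneg (y i))]
    gcongr
    exact hysq i
  have hoff := abs_sum_pairWeight_le hr e f
  -- the blocks containing a change point
  have hU : |x ⬝ᵥ (matU n a).mulVec x - y ⬝ᵥ (matU n a).mulVec y| ≤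
      16 * bad.card * b ^ 2 * (a / n) * ‖f‖ ^ 2 := by
    refine (abs_sub_dotProduct_matU_le ha hxy (C := (2 * b) ^ 2 * ‖f‖ ^ 2) (fun i => ?_) hysq bad
      (fun m hm i hi k hk => by simp only [hu, hbad m hm i hi k hk])).trans ?_
    · exact sq_inner_le ((hφ i).trans (by linarith))
    · calc _ ≤ (bad.card : ℝ) * (2 * ((2 * b) ^ 2 * ‖f‖ ^ 2) * (2 * (a / n))) := by
            gcongr
            exact one_div_numBlocks_le hr
        _ = _ := by ring
  have hyU := dotProduct_matU_mulVec_eq_sum_pairWeight ha hr y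
  have hL : x ⬝ᵥ (matL n).mulVec x = 1 / n * centeredSS Finset.univ u +
      1 / n * ∑ i, y i ^ 2 - ((∑ i, y i) / n) ^ 2 +
        2 * (1 / (n : ℝ) * ∑ i, y i * (u i - (∑ k, u k) / n)) := by
    rw [dotProduct_matL_mulVec, show x = fun i => u i + y i from funext hxy, centeredSS_add,
      centeredSS_eq Finset.univ y]
    simp only [Finset.card_univ, Fintype.card_fin]
    field_simp
    ring
  have hsplit : ∑ i : Fin n, (1 / (n : ℝ) - 1 / (((n / a : ℕ) : ℝ) * (block n a (blockOf hr i)).card)) *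
      y i ^ 2 = 1 / n * ∑ i, y i ^ 2 -
        ∑ i, y i ^ 2 / (((n / a : ℕ) : ℝ) * (block n a (blockOf hr i)).card) := by
    rw [Finset.mul_sum, ← Finset.sum_sub_distrib]
    exact Finset.sum_congr rfl fun i _ => by ring
  -- The constants come from this identity: `6 = 2·2 + 2` from the doubled cross term and the
  -- squared mean, `8 = 2·2²` from the diagonal, and `16 = 2·2²·2` from each bad block, using `‖e i‖
  -- ≤ 2b` and `1/r ≤ 2a/n`.
  have hQ : quadForm (matL n - matU n a) φ f - 1 / n * centeredSS Finset.univ u =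
      2 * (1 / (n : ℝ) * ∑ i, y i * (u i - (∑ k, u k) / n)) - ((∑ i, y i) / n) ^ 2 +
      (∑ i : Fin n, (1 / (n : ℝ) - 1 / (((n / a : ℕ) : ℝ) * (block n a (blockOf hr i)).card)) * y i ^ 2) +
      (∑ i, ∑ j, pairWeight hr i j * (y i * y j)) -
      (x ⬝ᵥ (matU n a).mulVec x - y ⬝ᵥ (matU n a).mulVec y) := by
    rw [quadForm, Matrix.sub_mulVec, dotProduct_sub, hsplit, hyU]
    change x ⬝ᵥ (matL n).mulVec x - _ - _ = _
    rw [hL]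
    ring
  rw [hQ]
  have h0 := sq_nonneg ((∑ i, y i) / n)
  rw [abs_le] at hcross hdiag hoff hU ⊢
  constructor <;> nlinarith

end Decomposition

/-! ### Measurability and mean elements -/

section MeanElement

variable {𝓧 : Type*} {H : Type*} [NormedAddCommGroup H] [InnerProductSpace ℝ H] [CompleteSpace H]
  [RKHS ℝ H 𝓧 ℝ]

theorem norm_featureMap_le {x : 𝓧} {B : ℝ} (h : kernelFun H x x ≤ B) :
    ‖featureMap H x‖ ≤ Real.sqrt B := by
  rw [kernelFun, real_inner_self_eq_norm_sq] at h
  exact Real.le_sqrt_of_sq_le h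

variable [MeasurableSpace 𝓧]

/-- The vectors `f` with this property form a closed subspace containing all kernel sections, and
these span a dense subspace. Separability of `H` is not required. -/
theorem measurable_inner_featureMap
    (hK : Measurable fun p : 𝓧 × 𝓧 => kernelFun H p.1 p.2) (f : H) :
    Measurable fun x : 𝓧 => ⟪featureMap H x, f⟫_ℝ := by
  let V : Submodule ℝ H :=
    { carrier := {f | Measurable fun x : 𝓧 => ⟪featureMap H x, f⟫_ℝ}
      add_mem' := fun {f g} hf hg => by
        simp only [Set.mem_ofPred_eq, inner_add_right] at *
        exact hf.add hg
      zero_mem' := by simp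
      smul_mem' := fun c f hf => by
        simp only [Set.mem_ofPred_eq, real_inner_smul_right] at *
        exact hf.const_mul c }
  have hclosed : IsClosed (V : Set H) := by
    refine IsSeqClosed.isClosed fun u f hu hf => ?_
    refine measurable_of_tendsto_metrizable (fun k => hu k) (tendsto_pi_nhds.2 fun x => ?_)
    exact (tendsto_const_nhds (x := featureMap H x)).inner hf
  have hspan : Submodule.span ℝ {RKHS.kerFun H x v | (x : 𝓧) (v : ℝ)} ≤ V := by
    rw [Submodule.span_le]
    rintro _ ⟨y, v, rfl⟩
    have h1 : RKHS.kerFun H y v = v • featureMap H y := by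
      rw [featureMap, ← map_smul, smul_eq_mul, mul_one]
    rw [h1]
    refine V.smul_mem v ?_
    have h3 := hK.comp (measurable_prodMk_right (y := y))
    simp only [Function.comp_def] at h3
    exact h3
  have h2 := (Submodule.topologicalClosure_minimal _ hspan hclosed)
  rw [RKHS.kerFun_dense] at h2
  exact h2 Submodule.mem_top

theorem measurable_inner_sub_sub
    (hK : Measurable fun p : 𝓧 × 𝓧 => kernelFun H p.1 p.2) (m m' : H) :
    Measurable fun p : 𝓧 × 𝓧 => ⟪featureMap H p.1 - m, featureMap H p.2 - m'⟫_ℝ := by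
  have h1 : (fun p : 𝓧 × 𝓧 => ⟪featureMap H p.1 - m, featureMap H p.2 - m'⟫_ℝ) = fun p =>
      kernelFun H p.1 p.2 - ⟪featureMap H p.1, m'⟫_ℝ - (⟪featureMap H p.2, m⟫_ℝ - ⟪m, m'⟫_ℝ) := by
    ext p
    rw [inner_sub_left, inner_sub_right, inner_sub_right, real_inner_comm m (featureMap H p.2),
      kernelFun]
  rw [h1]
  exact (hK.sub ((measurable_inner_featureMap hK m').comp measurable_fst)).sub
    (((measurable_inner_featureMap hK m).comp measurable_snd).sub_const _)

theorem measurable_inner_sub_sub_comp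
    (hK : Measurable fun p : 𝓧 × 𝓧 => kernelFun H p.1 p.2) (m m' : H) {α : Type*}
    [MeasurableSpace α] {u v : α → 𝓧} (hu : Measurable u) (hv : Measurable v) :
    Measurable fun a => ⟪featureMap H (u a) - m, featureMap H (v a) - m'⟫_ℝ := by
  have h := (measurable_inner_sub_sub hK m m').comp (hu.prodMk hv)
  simpa only [Function.comp_def] using h

variable {P : Measure 𝓧} [IsProbabilityMeasure P] {B : ℝ}

theorem integrable_inner_featureMap (hK : Measurable fun p : 𝓧 × 𝓧 => kernelFun H p.1 p.2)
    (hB : ∀ᵐ x ∂P, kernelFun H x x ≤ B) (f : H) :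
    Integrable (fun x => ⟪featureMap H x, f⟫_ℝ) P := by
  refine Integrable.of_bound (measurable_inner_featureMap hK f).aestronglyMeasurable
    (Real.sqrt B * ‖f‖) ?_
  filter_upwards [hB] with x hx
  exact (norm_inner_le_norm _ _).trans (by gcongr; exact norm_featureMap_le hx)

theorem abs_integral_inner_featureMap_le
    (hB : ∀ᵐ x ∂P, kernelFun H x x ≤ B) (f : H) :
    ‖∫ x, ⟪featureMap H x, f⟫_ℝ ∂P‖ ≤ Real.sqrt B * ‖f‖ := by
  have h := norm_integral_le_of_norm_le_const (μ := P) (f := fun x => ⟪featureMap H x, f⟫_ℝ)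
    (C := Real.sqrt B * ‖f‖) (by
      filter_upwards [hB] with x hx
      exact (norm_inner_le_norm _ _).trans (by gcongr; exact norm_featureMap_le hx))
  simpa using h

/-- By the Riesz representation theorem: the expectation is a bounded functional of `f`. Only the
weak integral is used, so the feature map need not be Bochner measurable. -/
theorem exists_isMeanElement (hK : Measurable fun p : 𝓧 × 𝓧 => kernelFun H p.1 p.2)
    (hB : ∀ᵐ x ∂P, kernelFun H x x ≤ B) : ∃ m : H, IsMeanElement H P m := by
  let F : H →ₗ[ℝ] ℝ :=
    { toFun := fun f => ∫ x, ⟪featureMap H x, f⟫_ℝ ∂P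
      map_add' := fun f g => by
        simp only [inner_add_right]
        exact integral_add (integrable_inner_featureMap hK hB f)
          (integrable_inner_featureMap hK hB g)
      map_smul' := fun c f => by
        simp only [real_inner_smul_right, RingHom.id_apply, smul_eq_mul]
        exact integral_const_mul _ _ }
  let F' : StrongDual ℝ H := F.mkContinuous (Real.sqrt B) (abs_integral_inner_featureMap_le hB)
  refine ⟨(InnerProductSpace.toDual ℝ H).symm F', fun f =>
    ⟨integrable_inner_featureMap hK hB f, ?_⟩⟩
  rw [InnerProductSpace.toDual_symm_apply]
  rfl

theorem isMeanElement_meanElement (hK : Measurable fun p : 𝓧 × 𝓧 => kernelFun H p.1 p.2)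
    (hB : ∀ᵐ x ∂P, kernelFun H x x ≤ B) : IsMeanElement H P (meanElement H P) := by
  rw [meanElement, dif_pos (exists_isMeanElement hK hB)]
  exact (exists_isMeanElement hK hB).choose_spec

theorem IsMeanElement.norm_le {m : H} (hm : IsMeanElement H P m)
    (hB : ∀ᵐ x ∂P, kernelFun H x x ≤ B) : ‖m‖ ≤ Real.sqrt B := by
  have h1 := abs_integral_inner_featureMap_le hB m
  rw [← (hm m).2, real_inner_self_eq_norm_sq, Real.norm_eq_abs, abs_of_nonneg (sq_nonneg _)] at h1
  by_contra! h
  have h2 := (Real.sqrt_nonneg B).trans_lt h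
  nlinarith

theorem IsMeanElement.integral_inner_sub {m : H} (hm : IsMeanElement H P m) (f : H) :
    ∫ x, ⟪featureMap H x - m, f⟫_ℝ ∂P = 0 := by
  simp only [inner_sub_left]
  rw [integral_sub (hm f).1 (integrable_const _), ← (hm f).2]
  simp

end MeanElement

/-! ### Second moments -/

section SecondMoment

variable {Ω : Type*} [MeasurableSpace Ω] {μ : Measure Ω} [IsProbabilityMeasure μ]

/-- Chebyshev's inequality for a combination of pairwise uncorrelated random vectors. -/
theorem measureReal_norm_sum_smul_ge_le {κ V : Type*} [NormedAddCommGroup V]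
    [InnerProductSpace ℝ V] (S : Finset κ) (β : κ → ℝ) (ψ : κ → Ω → V)
    (hint : ∀ p ∈ S, ∀ q ∈ S, Integrable (fun ω => ⟪ψ p ω, ψ q ω⟫_ℝ) μ)
    (hzero : ∀ p ∈ S, ∀ q ∈ S, p ≠ q → ∫ ω, ⟪ψ p ω, ψ q ω⟫_ℝ ∂μ = 0) {C : ℝ}
    (hC : ∀ p ∈ S, ∀ᵐ ω ∂μ, ‖ψ p ω‖ ^ 2 ≤ C) {t : ℝ} (ht : 0 < t) :
    μ.real {ω | t ≤ ‖∑ p ∈ S, β p • ψ p ω‖} ≤ C * (∑ p ∈ S, β p ^ 2) / t ^ 2 := by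
  classical
  have hexp : ∀ ω, ‖∑ p ∈ S, β p • ψ p ω‖ ^ 2 =
      ∑ p ∈ S, ∑ q ∈ S, β p * β q * ⟪ψ p ω, ψ q ω⟫_ℝ := by
    intro ω
    rw [← real_inner_self_eq_norm_sq, sum_inner]
    refine Finset.sum_congr rfl fun p _ => ?_
    rw [inner_sum]
    refine Finset.sum_congr rfl fun q _ => ?_
    rw [real_inner_smul_left, real_inner_smul_right]
    ring
  have hI : Integrable (fun ω => ‖∑ p ∈ S, β p • ψ p ω‖ ^ 2) μ := by
    simp only [hexp]
    exact integrable_finsetSum _ fun p hp => integrable_finsetSum _ fun q hq =>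
      (hint p hp q hq).const_mul _
  have hE : ∫ ω, ‖∑ p ∈ S, β p • ψ p ω‖ ^ 2 ∂μ ≤ C * ∑ p ∈ S, β p ^ 2 := by
    simp only [hexp]
    rw [integral_finsetSum _ fun p hp => integrable_finsetSum _ fun q hq =>
      (hint p hp q hq).const_mul _, Finset.mul_sum]
    refine Finset.sum_le_sum fun p hp => ?_
    rw [integral_finsetSum _ fun q hq => (hint p hp q hq).const_mul _,
      Finset.sum_eq_single p]
    · rw [integral_const_mul, ← sq, mul_comm]
      refine mul_le_mul_of_nonneg_right ?_ (sq_nonneg _)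
      have := integral_mono_ae (hint p hp p hp) (integrable_const C) (by
        filter_upwards [hC p hp] with ω hω
        rw [real_inner_self_eq_norm_sq]
        exact hω)
      simpa using this
    · intro q hq hqp
      rw [integral_const_mul, hzero p hp q hq hqp.symm, mul_zero]
    · exact fun h => absurd hp h
  have hM := mul_meas_ge_le_integral_of_nonneg (μ := μ)
    (Eventually.of_forall fun ω => sq_nonneg ‖∑ p ∈ S, β p • ψ p ω‖) hI (t ^ 2)
  have hset : {ω | t ≤ ‖∑ p ∈ S, β p • ψ p ω‖} = {ω | t ^ 2 ≤ ‖∑ p ∈ S, β p • ψ p ω‖ ^ 2} := by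
    ext ω
    simp only [Set.mem_ofPred_eq]
    exact (pow_le_pow_iff_left₀ ht.le (norm_nonneg _) two_ne_zero).symm
  rw [hset, le_div_iff₀ (by positivity), mul_comm]
  exact hM.trans hE

end SecondMoment

/-! ### Orthogonality of centered features under independence -/

section Centered

variable {𝓧 : Type*} [MeasurableSpace 𝓧] {H : Type*} [NormedAddCommGroup H] [InnerProductSpace ℝ H]
  [CompleteSpace H] [RKHS ℝ H 𝓧 ℝ] {Ω : Type*} [MeasurableSpace Ω] {μ : Measure Ω}
  [IsProbabilityMeasure μ]

/-- By independence and Fubini, integrating over `Y` first with `Z` fixed gives zero. The variable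
`Z` is general so that it can collect several observations. -/
theorem integral_inner_centered_eq_zero {𝓩 : Type*} [MeasurableSpace 𝓩] {Y : Ω → 𝓧} {Z : Ω → 𝓩}
    (hY : Measurable Y) (hZ : Measurable Z) (hYZ : IndepFun Y Z μ) {m : H}
    (hm : IsMeanElement H (μ.map Y) m) (g : 𝓩 → H)
    (hg : Measurable fun p : 𝓧 × 𝓩 => ⟪featureMap H p.1 - m, g p.2⟫_ℝ) :
    ∫ ω, ⟪featureMap H (Y ω) - m, g (Z ω)⟫_ℝ ∂μ = 0 := by
  have : IsProbabilityMeasure (μ.map Y) := Measure.isProbabilityMeasure_map hY.aemeasurable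
  have : IsProbabilityMeasure (μ.map Z) := Measure.isProbabilityMeasure_map hZ.aemeasurable
  have h1 : ∫ ω, ⟪featureMap H (Y ω) - m, g (Z ω)⟫_ℝ ∂μ =
      ∫ p, ⟪featureMap H p.1 - m, g p.2⟫_ℝ ∂((μ.map Y).prod (μ.map Z)) := by
    rw [← (indepFun_iff_map_prod_eq_prod_map_map hY.aemeasurable hZ.aemeasurable).1 hYZ,
      integral_map (hY.prodMk hZ).aemeasurable hg.aestronglyMeasurable]
  rw [h1]
  by_cases hI : Integrable (fun p : 𝓧 × 𝓩 => ⟪featureMap H p.1 - m, g p.2⟫_ℝ)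
      ((μ.map Y).prod (μ.map Z))
  · rw [integral_prod_symm _ hI]
    simp [hm.integral_inner_sub]
  · exact integral_undef hI

variable {ι : Type*} {X : ι → Ω → 𝓧} {m : ι → H} {b : ℝ}

theorem measurable_inner_centered (hK : Measurable fun p : 𝓧 × 𝓧 => kernelFun H p.1 p.2)
    (hX : ∀ i, Measurable (X i)) (i k : ι) :
    Measurable fun ω => ⟪featureMap H (X i ω) - m i, featureMap H (X k ω) - m k⟫_ℝ :=
  measurable_inner_sub_sub_comp hK (m i) (m k) (hX i) (hX k)

theorem integrable_inner_centered (hK : Measurable fun p : 𝓧 × 𝓧 => kernelFun H p.1 p.2)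
    (hX : ∀ i, Measurable (X i)) (hb : ∀ i, ∀ᵐ ω ∂μ, ‖featureMap H (X i ω) - m i‖ ≤ b) (i k : ι) :
    Integrable (fun ω => ⟪featureMap H (X i ω) - m i, featureMap H (X k ω) - m k⟫_ℝ) μ := by
  refine Integrable.of_bound (measurable_inner_centered hK hX i k).aestronglyMeasurable (b * b) ?_
  filter_upwards [hb i, hb k] with ω hi hk
  refine (norm_inner_le_norm _ _).trans ?_
  have := norm_nonneg (featureMap H (X i ω) - m i)
  exact mul_le_mul hi hk (norm_nonneg _) (this.trans hi)

theorem integrable_inner_mul_inner_centered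
    (hK : Measurable fun p : 𝓧 × 𝓧 => kernelFun H p.1 p.2)
    (hX : ∀ i, Measurable (X i)) (hb : ∀ i, ∀ᵐ ω ∂μ, ‖featureMap H (X i ω) - m i‖ ≤ b)
    (i k j l : ι) :
    Integrable (fun ω => ⟪featureMap H (X i ω) - m i, featureMap H (X k ω) - m k⟫_ℝ *
      ⟪featureMap H (X j ω) - m j, featureMap H (X l ω) - m l⟫_ℝ) μ := by
  refine (integrable_inner_centered hK hX hb i k).mul_bdd (c := b * b)
    (measurable_inner_centered hK hX j l).aestronglyMeasurable ?_
  filter_upwards [hb j, hb l] with ω hi hk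
  refine (norm_inner_le_norm _ _).trans ?_
  have := norm_nonneg (featureMap H (X j ω) - m j)
  exact mul_le_mul hi hk (norm_nonneg _) (this.trans hi)

theorem integral_inner_centered_pair_eq_zero
    (hK : Measurable fun p : 𝓧 × 𝓧 => kernelFun H p.1 p.2)
    (hX : ∀ i, Measurable (X i)) (hindep : iIndepFun X μ)
    (hm : ∀ i, IsMeanElement H (μ.map (X i)) (m i)) {t p : ι} (htp : t ≠ p) :
    ∫ ω, ⟪featureMap H (X t ω) - m t, featureMap H (X p ω) - m p⟫_ℝ ∂μ = 0 :=
  integral_inner_centered_eq_zero (hX t) (hX p) (hindep.indepFun htp) (hm t)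
    (fun x => featureMap H x - m p) (measurable_inner_sub_sub hK (m t) (m p))

/-- The index `t` occurs only once, while `p`, `q`, `r` may coincide. The product is linear in the
centered feature at `t`, with coefficient vector `⟨e q, e r⟩ e p` depending only on observations
independent of `X t`. -/
theorem integral_inner_mul_inner_centered_eq_zero
    (hK : Measurable fun p : 𝓧 × 𝓧 => kernelFun H p.1 p.2)
    (hX : ∀ i, Measurable (X i)) (hindep : iIndepFun X μ)
    (hm : ∀ i, IsMeanElement H (μ.map (X i)) (m i)) {t p q r : ι} (htp : t ≠ p) (htq : t ≠ q)
    (htr : t ≠ r) :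
    ∫ ω, ⟪featureMap H (X t ω) - m t, featureMap H (X p ω) - m p⟫_ℝ *
      ⟪featureMap H (X q ω) - m q, featureMap H (X r ω) - m r⟫_ℝ ∂μ = 0 := by
  classical
  let T : Finset ι := {p, q, r}
  let p' : T := ⟨p, by simp [T]⟩
  let q' : T := ⟨q, by simp [T]⟩
  let r' : T := ⟨r, by simp [T]⟩
  have hdisj : Disjoint ({t} : Finset ι) T := by
    simp [T, htp, htq, htr]
  have hi := (hindep.indepFun_finset {t} T hdisj hX).comp
    (measurable_pi_apply (⟨t, Finset.mem_singleton_self t⟩ : ({t} : Finset ι))) measurable_id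
  have hZ : Measurable fun ω (i : T) => X i ω := measurable_pi_lambda _ fun i => hX i
  have hqr : Measurable fun a : 𝓧 × (T → 𝓧) =>
      ⟪featureMap H (a.2 q') - m q, featureMap H (a.2 r') - m r⟫_ℝ := by
    exact measurable_inner_sub_sub_comp hK (m q) (m r) (u := fun a : 𝓧 × (T → 𝓧) => a.2 q')
      (v := fun a : 𝓧 × (T → 𝓧) => a.2 r') (by fun_prop) (by fun_prop)
  have htp' : Measurable fun a : 𝓧 × (T → 𝓧) =>
      ⟪featureMap H a.1 - m t, featureMap H (a.2 p') - m p⟫_ℝ := by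
    exact measurable_inner_sub_sub_comp hK (m t) (m p) (u := fun a : 𝓧 × (T → 𝓧) => a.1)
      (v := fun a : 𝓧 × (T → 𝓧) => a.2 p') (by fun_prop) (by fun_prop)
  have := integral_inner_centered_eq_zero (H := H) (hX t) hZ hi (hm t)
    (fun z => ⟪featureMap H (z q') - m q, featureMap H (z r') - m r⟫_ℝ •
      (featureMap H (z p') - m p))
    (by simp only [real_inner_smul_right]; exact hqr.mul htp')
  rw [← this]
  refine integral_congr_ae (Eventually.of_forall fun ω => ?_)
  simp only [real_inner_smul_right, p', q', r']
  ring

variable {n a : ℕ}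

open scoped TensorProduct in
/-- The off-diagonal within-block term is of order `n ^ (-1/2)` in probability. -/
theorem measureReal_norm_offDiagonal_ge_le {X : Fin n → Ω → 𝓧} {m : Fin n → H} (ha : 2 ≤ a)
    (hr : 0 < n / a) (hK : Measurable fun p : 𝓧 × 𝓧 => kernelFun H p.1 p.2)
    (hX : ∀ i, Measurable (X i)) (hindep : iIndepFun X μ)
    (hm : ∀ i, IsMeanElement H (μ.map (X i)) (m i))
    (hb : ∀ i, ∀ᵐ ω ∂μ, ‖featureMap H (X i ω) - m i‖ ≤ b) {t : ℝ} (ht : 0 < t) :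
    μ.real {ω | t ≤ ‖offDiagonal hr (fun i => featureMap H (X i ω) - m i)‖} ≤
      b ^ 4 * (16 / n) / t ^ 2 := by
  let e : Fin n → Ω → H := fun i ω => featureMap H (X i ω) - m i
  let S : Finset (Fin n × Fin n) := Finset.univ.filter fun p => p.1 < p.2
  have hsum : ∀ ω, offDiagonal hr (fun i => featureMap H (X i ω) - m i) =
      ∑ p ∈ S, pairWeight hr p.1 p.2 • (e p.1 ω ⊗ₜ[ℝ] e p.2 ω) := by
    intro ω
    rw [offDiagonal, Finset.sum_filter]
    refine Finset.sum_congr rfl fun p _ => ?_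
    split_ifs with h
    · rfl
    · simp [pairWeight, h]
  have hinner : ∀ (i j k l : Fin n) (ω : Ω),
      (InnerProductSpace.toInner (𝕜 := ℝ) (E := H ⊗[ℝ] H)).inner
        (e i ω ⊗ₜ[ℝ] e j ω) (e k ω ⊗ₜ[ℝ] e l ω) =
      ⟪e i ω, e k ω⟫_ℝ * ⟪e j ω, e l ω⟫_ℝ := fun i j k l ω => TensorProduct.inner_tmul _ _ _ _ _
  simp only [hsum]
  have key := measureReal_norm_sum_smul_ge_le (μ := μ) S (fun p => pairWeight hr p.1 p.2)
    (fun p ω => e p.1 ω ⊗ₜ[ℝ] e p.2 ω) (C := b ^ 4) ?_ ?_ ?_ ht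
  · refine key.trans ?_
    gcongr
    refine le_trans ?_ (sum_pairWeight_sq_le ha hr)
    rw [← Fintype.sum_prod_type']
    exact Finset.sum_le_sum_of_subset_of_nonneg (Finset.filter_subset _ _)
      fun _ _ _ => sq_nonneg _
  · intro p _ q _
    simp only [hinner]
    exact integrable_inner_mul_inner_centered hK hX hb _ _ _ _
  · rintro ⟨i, j⟩ hp ⟨k, l⟩ hq hpq
    simp only [hinner]
    have hij : i < j := (Finset.mem_filter.1 hp).2
    have hkl : k < l := (Finset.mem_filter.1 hq).2
    -- Two distinct ordered pairs always have an index occurring once among the four: the larger of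
    -- `j` and `l` if these differ, and `i` if `j = l`.
    rcases lt_trichotomy j l with hjl | rfl | hlj
    · rw [← integral_inner_mul_inner_centered_eq_zero hK hX hindep hm (t := l) (p := j) (q := i)
        (r := k) hjl.ne' (hij.trans hjl).ne' hkl.ne']
      refine integral_congr_ae (Eventually.of_forall fun ω => ?_)
      simp only [e, real_inner_comm (featureMap H (X j ω) - m j)]
      ring
    · have hik : i ≠ k := fun h => hpq (by rw [h])
      exact integral_inner_mul_inner_centered_eq_zero hK hX hindep hm hik hij.ne hij.ne
    · rw [← integral_inner_mul_inner_centered_eq_zero hK hX hindep hm (t := j) (p := l) (q := i)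
        (r := k) hlj.ne' hij.ne' (hkl.trans hlj).ne']
      refine integral_congr_ae (Eventually.of_forall fun ω => ?_)
      simp only [e]
      ring
  · intro p _
    filter_upwards [hb p.1, hb p.2] with ω h1 h2
    rw [TensorProduct.norm_tmul]
    have h0 := (norm_nonneg _).trans h1
    calc (‖e p.1 ω‖ * ‖e p.2 ω‖) ^ 2 ≤ (b * b) ^ 2 := by gcongr
      _ = b ^ 4 := by ring

theorem measureReal_norm_segmentMean_ge_le {κ : Type*} [DecidableEq κ] {X : Fin n → Ω → 𝓧}
    {m : Fin n → H} (seg : Fin n → κ) (j : κ) (hn : 0 < n)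
    (hK : Measurable fun p : 𝓧 × 𝓧 => kernelFun H p.1 p.2)
    (hX : ∀ i, Measurable (X i)) (hindep : iIndepFun X μ)
    (hm : ∀ i, IsMeanElement H (μ.map (X i)) (m i))
    (hb : ∀ i, ∀ᵐ ω ∂μ, ‖featureMap H (X i ω) - m i‖ ≤ b) {t : ℝ} (ht : 0 < t) :
    μ.real {ω | t ≤ ‖segmentMean seg (fun i => featureMap H (X i ω) - m i) j‖} ≤
      b ^ 2 * (1 / n) / t ^ 2 := by
  have hn0 : (0 : ℝ) < n := by exact_mod_cast hn
  simp only [segmentMean, Finset.smul_sum]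
  refine (measureReal_norm_sum_smul_ge_le (μ := μ) _ (fun _ => 1 / (n : ℝ))
    (fun i ω => featureMap H (X i ω) - m i) (C := b ^ 2) ?_ ?_ ?_ ht).trans ?_
  · exact fun p _ q _ => integrable_inner_centered hK hX hb p q
  · exact fun p _ q _ hpq => integral_inner_centered_pair_eq_zero hK hX hindep hm hpq
  · intro p _
    filter_upwards [hb p] with ω h
    gcongr
  · gcongr
    rw [Finset.sum_const, nsmul_eq_mul]
    calc _ ≤ (n : ℝ) * (1 / (n : ℝ)) ^ 2 := by
          gcongr
          simpa using Finset.card_filter_le (Finset.univ : Finset (Fin n)) (fun i => seg i = j)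
      _ = 1 / n := by field_simp

end Centered

/-! ### The estimator under a deterministic spectral gap -/

section Deterministic

variable {𝓧 : Type*} {H : Type*} [NormedAddCommGroup H] [InnerProductSpace ℝ H] [CompleteSpace H]
  [RKHS ℝ H 𝓧 ℝ]

/-- The estimator takes the largest admissible index, so ratios below `q` are irrelevant. Beyond `q`
every ratio is at least `(1 - ε)/(1 + ε) > τ`, and at `q ≥ 1` the ratio is at most `(1 + ε) c / (δ +
c) ≤ τ`. For `q = 0` only the first part matters, by the convention for the empty set. -/
theorem qHat_eq_of_eigval {n a q : ℕ} {c τ ε δ : ℝ} {x : Fin n → 𝓧} (hq : q + 1 ≤ n) (hc : 0 < c)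
    (hε0 : 0 ≤ ε) (hε1 : ε < 1) (hτ : τ * (1 + ε) < 1 - ε) (hτ0 : 0 < τ) (hδ : 0 < δ)
    (hcδ : (1 + ε) * c ≤ τ * δ) (hlarge : 1 ≤ q → δ ≤ eigval (targetMatrix H a x) q)
    (hsmall : ∀ k, q < k → k ≤ n → |eigval (targetMatrix H a x) k| ≤ ε * c) :
    qHat H a c τ x = q := by
  refine le_antisymm (Finset.sup_le fun k hk => ?_) ?_
  · rw [Finset.mem_filter, Finset.mem_Icc] at hk
    obtain ⟨⟨hk1, hkn⟩, hkτ⟩ := hk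
    by_contra! hlt
    simp only [id] at hlt
    have h1 := abs_le.1 (hsmall k hlt (by omega))
    have h2 := abs_le.1 (hsmall (k + 1) (by omega) (by omega))
    have h3 : 0 < eigval (targetMatrix H a x) k + c := by nlinarith
    rw [ridgeRatio, div_le_iff₀ h3] at hkτ
    nlinarith
  · rcases Nat.eq_zero_or_pos q with rfl | hq1
    · exact Nat.zero_le _
    · refine Finset.le_sup (f := id) (Finset.mem_filter.2 ⟨Finset.mem_Icc.2 ⟨hq1, by omega⟩, ?_⟩)
      have h1 := hlarge hq1
      have h2 := abs_le.1 (hsmall (q + 1) (by omega) hq)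
      rw [ridgeRatio, div_le_iff₀ (by linarith)]
      nlinarith

/-- The gap `2δ` on `D` absorbs the error `ε c ≤ δ` and leaves `δ`. Off `D` the error alone bounds
the eigenvalues, and nonnegativity of `Qpop` gives the bound from below. -/
theorem qHat_eq_of_quadForm {n a : ℕ} {c τ ε δ : ℝ} {x : Fin n → 𝓧} (D : Submodule ℝ H)
    [FiniteDimensional ℝ D] (hq : Module.finrank ℝ D + 1 ≤ n) (hc : 0 < c) (hε0 : 0 ≤ ε)
    (hε1 : ε < 1) (hτ : τ * (1 + ε) < 1 - ε) (hτ0 : 0 < τ) (hδ : 0 < δ)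
    (hcδ : (1 + ε) * c ≤ τ * δ) (hεδ : ε * c ≤ δ) (Qpop : H → ℝ)
    (hQ : ∀ f, |quadForm (matL n - matU n a) (fun i => featureMap H (x i)) f - Qpop f| ≤
      ε * c * ‖f‖ ^ 2)
    (hpos : ∀ f, 0 ≤ Qpop f) (hD : ∀ f ∈ D, 2 * δ * ‖f‖ ^ 2 ≤ Qpop f)
    (hDo : ∀ f ∈ Dᗮ, Qpop f = 0) : qHat H a c τ x = Module.finrank ℝ D := by
  have hM : (matL n - matU n a).IsSymm := (isSymm_matL n).sub (isSymm_matU n a)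
  have hεc : 0 ≤ ε * c := mul_nonneg hε0 hc.le
  refine qHat_eq_of_eigval hq hc hε0 hε1 hτ hτ0 hδ hcδ (fun h1 => ?_) fun k hk hkn => ?_
  · refine le_eigval_of_forall_mem hM (fun i => featureMap H (x i)) D h1 le_rfl (by omega) hδ
      fun f hf => ?_
    have h2 := abs_le.1 (hQ f)
    have h3 := hD f hf
    nlinarith [sq_nonneg ‖f‖]
  · rw [abs_le]
    constructor
    · refine neg_le_eigval_of_forall hM (fun i => featureMap H (x i)) (by omega) hkn hεc
        fun f => ?_
      have h2 := abs_le.1 (hQ f)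
      have h3 := hpos f
      linarith
    · refine eigval_le_of_forall_mem_orthogonal hM (fun i => featureMap H (x i)) D hk hkn hεc
        fun f hf => ?_
      have h2 := abs_le.1 (hQ f)
      have h3 := hDo f hf
      linarith

end Deterministic

/-! ### The between-segment quadratic form -/

section Population

variable {H : Type*} [NormedAddCommGroup H] [InnerProductSpace ℝ H]

/-- A vector of the span orthogonal to every `v p` is zero, so `f ↦ (⟨v p, f⟩)` is injective on a
finite-dimensional space, hence bounded below. -/
theorem exists_pos_mul_norm_sq_le_sum_inner_sq {κ : Type*} [Fintype κ] (v : κ → H) :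
    ∃ δ > 0, ∀ f ∈ Submodule.span ℝ (Set.range v), δ * ‖f‖ ^ 2 ≤ ∑ p, ⟪v p, f⟫_ℝ ^ 2 := by
  let D := Submodule.span ℝ (Set.range v)
  have : FiniteDimensional ℝ D := FiniteDimensional.span_of_finite ℝ (Set.finite_range v)
  let F : D →ₗ[ℝ] EuclideanSpace ℝ κ :=
    { toFun := fun f => WithLp.toLp 2 fun p => ⟪v p, (f : H)⟫_ℝ
      map_add' := fun f g => by ext p; simp [inner_add_right]
      map_smul' := fun r f => by ext p; simp [real_inner_smul_right] }
  have hF : LinearMap.ker F = ⊥ := by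
    rw [LinearMap.ker_eq_bot']
    intro f hf
    have h1 : ∀ p, ⟪v p, (f : H)⟫_ℝ = 0 := fun p => by
      have := congrArg (fun w : EuclideanSpace ℝ κ => w p) hf
      simpa [F] using this
    have h2 : (f : H) ∈ Dᗮ := by
      rw [Submodule.mem_orthogonal]
      intro u hu
      induction hu using Submodule.span_induction with
      | mem u hu => obtain ⟨p, rfl⟩ := hu; exact h1 p
      | zero => simp
      | add u w _ _ hu hw => rw [inner_add_left, hu, hw, add_zero]
      | smul r u _ hu => rw [real_inner_smul_left, hu, mul_zero]
    have h3 := Submodule.inner_right_of_mem_orthogonal f.2 h2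
    exact Subtype.ext (inner_self_eq_zero.1 h3)
  obtain ⟨C, hC0, hC⟩ := F.exists_antilipschitzWith hF
  refine ⟨((C : ℝ) ^ 2)⁻¹, by positivity, fun f hf => ?_⟩
  have h1 := hC.le_mul_dist (⟨f, hf⟩ : D) 0
  rw [map_zero, dist_zero_right, dist_zero_right] at h1
  have h2 : ‖F ⟨f, hf⟩‖ ^ 2 = ∑ p, ⟪v p, f⟫_ℝ ^ 2 := by
    rw [EuclideanSpace.norm_sq_eq]
    simp [F]
  rw [← h2, inv_mul_le_iff₀ (by positivity), ← mul_pow]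
  gcongr
  exact h1

variable {n : ℕ} {ι : Type*}

/-- Each squared difference of two segment values is at most twice the sum of their squared
deviations from the overall mean, and every such deviation is repeated at least `κ n` times in the
sample. -/
theorem le_centeredSS_of_card_le [Fintype ι] [DecidableEq ι] (seg : Fin n → ι) (μ : ι → H) {κ : ℝ} (hκ : 0 ≤ κ)
    (hseg : ∀ j, κ * n ≤ (Finset.univ.filter fun i => seg i = j).card) (hn : 0 < n) (f : H) :
    κ / (4 * Fintype.card ι) * ∑ p : ι × ι, ⟪μ p.1 - μ p.2, f⟫_ℝ ^ 2 ≤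
      1 / n * centeredSS Finset.univ (fun i => ⟪μ (seg i), f⟫_ℝ) := by
  have hn0 : (0 : ℝ) < n := by exact_mod_cast hn
  have hι : (0 : ℝ) < Fintype.card ι := by
    have : 0 < Fintype.card ι := Fintype.card_pos_iff.2 ⟨seg ⟨0, hn⟩⟩
    exact_mod_cast this
  set ubar : ℝ := (∑ k : Fin n, ⟪μ (seg k), f⟫_ℝ) / (Finset.univ : Finset (Fin n)).card
  set g : ι → ℝ := fun j => (⟪μ j, f⟫_ℝ - ubar) ^ 2 with hg
  have h1 : centeredSS Finset.univ (fun i => ⟪μ (seg i), f⟫_ℝ) =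
      ∑ j, ((Finset.univ.filter fun i => seg i = j).card : ℝ) * g j := by
    rw [centeredSS, ← Finset.sum_fiberwise Finset.univ seg]
    refine Finset.sum_congr rfl fun j _ => ?_
    rw [← nsmul_eq_mul, ← Finset.sum_const]
    refine Finset.sum_congr rfl fun i hi => ?_
    rw [(Finset.mem_filter.1 hi).2]
  have h2 : κ * n * ∑ j, g j ≤ centeredSS Finset.univ (fun i => ⟪μ (seg i), f⟫_ℝ) := by
    rw [h1, Finset.mul_sum]
    exact Finset.sum_le_sum fun j _ => mul_le_mul_of_nonneg_right (hseg j) (sq_nonneg _)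
  have h3 : ∑ p : ι × ι, ⟪μ p.1 - μ p.2, f⟫_ℝ ^ 2 ≤ 4 * Fintype.card ι * ∑ j, g j := by
    have h4 : ∀ p : ι × ι, ⟪μ p.1 - μ p.2, f⟫_ℝ ^ 2 ≤ 2 * g p.1 + 2 * g p.2 := fun p => by
      rw [inner_sub_left]
      simp only [hg]
      nlinarith [sq_nonneg ((⟪μ p.1, f⟫_ℝ - ubar) + (⟪μ p.2, f⟫_ℝ - ubar))]
    refine (Finset.sum_le_sum fun p _ => h4 p).trans (le_of_eq ?_)
    rw [Fintype.sum_prod_type]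
    simp only [Finset.sum_add_distrib, Finset.sum_const, Finset.card_univ, nsmul_eq_mul,
      ← Finset.mul_sum]
    ring
  calc κ / (4 * Fintype.card ι) * ∑ p : ι × ι, ⟪μ p.1 - μ p.2, f⟫_ℝ ^ 2
      ≤ κ / (4 * Fintype.card ι) * (4 * Fintype.card ι * ∑ j, g j) := by gcongr
    _ = 1 / n * (κ * n * ∑ j, g j) := by field_simp
    _ ≤ _ := by gcongr

theorem centeredSS_eq_zero_of_mem_orthogonal (seg : Fin n → ι) (μ : ι → H) {f : H}
    (hf : f ∈ (Submodule.span ℝ (Set.range fun p : ι × ι => μ p.1 - μ p.2))ᗮ) :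
    centeredSS Finset.univ (fun i => ⟪μ (seg i), f⟫_ℝ) = 0 := by
  rcases Nat.eq_zero_or_pos n with rfl | hn
  · simp [centeredSS]
  rw [centeredSS_congr_add_const ⟪μ (seg ⟨0, hn⟩), f⟫_ℝ (w := fun _ => 0)]
  · simp [centeredSS]
  · intro i _
    have h := Submodule.inner_right_of_mem_orthogonal
      (Submodule.subset_span (Set.mem_range_self (seg i, seg ⟨0, hn⟩))) hf
    rw [inner_sub_left] at h
    linarith

end Population

/-! ### Segments between change points -/

section Segments

variable {s n : ℕ} {z : Fin (s + 2) → ℕ}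

theorem exists_segment (h0 : z 0 = 0) (hlast : z (Fin.last (s + 1)) = n) (i : Fin n) :
    ∃ j : Fin (s + 1), z j.castSucc ≤ i.val ∧ i.val < z j.succ := by
  by_contra! h
  have h1 : ∀ j : Fin (s + 2), z j ≤ i.val := by
    intro j
    induction j using Fin.induction with
    | zero => rw [h0]; exact Nat.zero_le _
    | succ j ih => exact h j ih
  have h2 := h1 (Fin.last (s + 1))
  have := i.isLt
  omega

theorem segment_unique (hz : Monotone z) {i : ℕ} {j k : Fin (s + 1)} (hj : z j.castSucc ≤ i)
    (hj' : i < z j.succ) (hk : z k.castSucc ≤ i) (hk' : i < z k.succ) : j = k := by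
  rcases lt_trichotomy j k with h | h | h
  · have := hz (Fin.succ_le_castSucc_iff.2 h)
    omega
  · exact h
  · have := hz (Fin.succ_le_castSucc_iff.2 h)
    omega

variable {seg : Fin n → Fin (s + 1)}

theorem le_card_segment (hz : Monotone z) (hlast : z (Fin.last (s + 1)) = n)
    (hseg : ∀ i, z (seg i).castSucc ≤ i.val ∧ i.val < z (seg i).succ) (j : Fin (s + 1)) :
    (z j.succ : ℝ) - z j.castSucc ≤ (Finset.univ.filter fun i => seg i = j).card := by
  have hle : z j.castSucc ≤ z j.succ := hz (Fin.castSucc_le_succ j)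
  have hsub : Finset.Ico (z j.castSucc) (z j.succ) ⊆
      (Finset.univ.filter fun i => seg i = j).image Fin.val := by
    intro i hi
    rw [Finset.mem_Ico] at hi
    have hin : i < n := by
      have := hz (Fin.le_last j.succ)
      omega
    refine Finset.mem_image.2 ⟨⟨i, hin⟩, Finset.mem_filter.2 ⟨Finset.mem_univ _, ?_⟩, rfl⟩
    exact segment_unique hz (hseg ⟨i, hin⟩).1 (hseg ⟨i, hin⟩).2 hi.1 hi.2
  have h1 := (Finset.card_le_card hsub).trans Finset.card_image_le
  rw [Nat.card_Ico] at h1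
  rw [← Nat.cast_sub hle]
  exact_mod_cast h1

/-- If a segment ends between two indices of one block, its end point is assigned to the same block,
as `blockOf` is monotone. Taking the image of all `s + 2` boundaries, `0` and `n` included, only
enlarges the exceptional set. -/
theorem segment_eq_of_notMem_image {a : ℕ} (hr : 0 < n / a) (hz : Monotone z)
    (hseg : ∀ i, z (seg i).castSucc ≤ i.val ∧ i.val < z (seg i).succ) (m : Fin (n / a))
    (hm : m ∉ Finset.univ.image fun j : Fin (s + 2) => blockOf hr (z j)) {i k : Fin n}
    (hi : i ∈ block n a m) (hk : k ∈ block n a m) : seg i = seg k := by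
  wlog hik : i ≤ k generalizing i k
  · exact (this hk hi (le_of_not_ge hik)).symm
  rw [mem_block_iff hr] at hi hk
  have hik' : i.val ≤ k.val := hik
  by_cases h : k.val < z (seg i).succ
  · exact segment_unique hz ((hseg i).1.trans hik') h (hseg k).1 (hseg k).2
  · refine absurd (Finset.mem_image.2 ⟨(seg i).succ, Finset.mem_univ _, ?_⟩) hm
    refine le_antisymm ?_ ?_
    · rw [← hk]
      exact blockOf_mono hr (not_lt.1 h)
    · rw [← hi]
      exact blockOf_mono hr (hseg i).2.le

end Segments

/-! ### The probability of a wrong estimate -/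

section Probability

variable {𝓧 : Type*} [MeasurableSpace 𝓧] {H : Type*} [NormedAddCommGroup H] [InnerProductSpace ℝ H]
  [CompleteSpace H] [RKHS ℝ H 𝓧 ℝ] {Ω : Type*} [MeasurableSpace Ω] {Pr : Measure Ω}
  [IsProbabilityMeasure Pr]

/-- A nonasymptotic bound for the probability that the estimator misses the dimension. -/
theorem measure_qHat_ne_le {s n a : ℕ} (hK : Measurable fun p : 𝓧 × 𝓧 => kernelFun H p.1 p.2)
    (P : Fin (s + 1) → Measure 𝓧) [∀ j, IsProbabilityMeasure (P j)] {B : ℝ}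
    (hB : ∀ j, ∀ᵐ x ∂(P j), kernelFun H x x ≤ B) {z : Fin (s + 2) → ℕ} (hz_mono : Monotone z)
    (hz_zero : z 0 = 0) (hz_last : z (Fin.last (s + 1)) = n) {X : Fin n → Ω → 𝓧}
    (hX : ∀ i, Measurable (X i)) (hindep : iIndepFun X Pr)
    (hlaw : ∀ (i : Fin n) (j : Fin (s + 1)), z j.castSucc ≤ i.val → i.val < z j.succ →
      Pr.map (X i) = P j) (ha : 2 ≤ a) (hr : 0 < n / a) {κ δ₀ c τ ε δ t : ℝ} (hκ : 0 ≤ κ)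
    (hweight : ∀ j : Fin (s + 1), κ * n ≤ (z j.succ : ℝ) - z j.castSucc)
    (hδ₀ : ∀ f ∈ deviationSubspace H P,
      δ₀ * ‖f‖ ^ 2 ≤ ∑ p : Fin (s + 1) × Fin (s + 1),
        ⟪meanElement H (P p.1) - meanElement H (P p.2), f⟫_ℝ ^ 2)
    (hδδ₀ : 2 * δ ≤ κ / (4 * (s + 1)) * δ₀) (hq : structuralDim H P + 1 ≤ n) (hc : 0 < c)
    (hε0 : 0 ≤ ε) (hε1 : ε < 1) (hτ : τ * (1 + ε) < 1 - ε) (hτ0 : 0 < τ) (hδ : 0 < δ)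
    (hcδ : (1 + ε) * c ≤ τ * δ) (hεδ : ε * c ≤ δ) (ht : 0 < t)
    (htc : (6 * Real.sqrt B * (s + 1) + 1) * t +
      (8 + 16 * (s + 2)) * Real.sqrt B ^ 2 * (a / n) ≤ ε * c) :
    Pr {ω | ¬ qHat H a c τ (fun i => X i ω) = structuralDim H P} ≤
      ENNReal.ofReal (((s + 1) * (2 * Real.sqrt B) ^ 2 + 16 * (2 * Real.sqrt B) ^ 4) *
        (1 / n / t ^ 2)) := by
  obtain ⟨-, hn⟩ := pos_of_numBlocks_pos hr
  set b := Real.sqrt B with hb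
  have hb0 : 0 ≤ b := Real.sqrt_nonneg B
  choose seg hseg using exists_segment hz_zero hz_last
  have hlaw' : ∀ i, Pr.map (X i) = P (seg i) := fun i => hlaw i _ (hseg i).1 (hseg i).2
  have hmean : ∀ j, IsMeanElement H (P j) (meanElement H (P j)) := fun j =>
    isMeanElement_meanElement hK (hB j)
  have hμb : ∀ j, ‖meanElement H (P j)‖ ≤ b := fun j => (hmean j).norm_le (hB j)
  have hmean' : ∀ i, IsMeanElement H (Pr.map (X i)) (meanElement H (P (seg i))) := fun i => by
    rw [hlaw' i]; exact hmean _
  have hφ : ∀ i, ∀ᵐ ω ∂Pr, ‖featureMap H (X i ω)‖ ≤ b := fun i => by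
    have h := hB (seg i)
    rw [← hlaw' i] at h
    filter_upwards [ae_of_ae_map (hX i).aemeasurable h] with ω hω using norm_featureMap_le hω
  have hcent : ∀ i, ∀ᵐ ω ∂Pr, ‖featureMap H (X i ω) - meanElement H (P (seg i))‖ ≤ 2 * b :=
    fun i => by
      filter_upwards [hφ i] with ω hω
      have := norm_sub_le (featureMap H (X i ω)) (meanElement H (P (seg i)))
      linarith [hμb (seg i)]
  set badSeg : Fin (s + 1) → Set Ω := fun j => {ω | t ≤ ‖segmentMean seg
    (fun i => featureMap H (X i ω) - meanElement H (P (seg i))) j‖} with hbadSeg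
  set badOff : Set Ω := {ω | t ≤ ‖offDiagonal hr
    (fun i => featureMap H (X i ω) - meanElement H (P (seg i)))‖} with hbadOff
  have : FiniteDimensional ℝ (deviationSubspace H P) :=
    FiniteDimensional.span_of_finite ℝ (Set.finite_range _)
  let bad : Finset (Fin (n / a)) := Finset.univ.image fun j : Fin (s + 2) => blockOf hr (z j)
  have hbadcard : (bad.card : ℝ) ≤ s + 2 := by
    have : bad.card ≤ s + 2 := Finset.card_image_le.trans (by simp)
    exact_mod_cast this
  -- The inclusion holds only almost surely, because the kernel bound does.
  have hsub : ({ω | ¬ qHat H a c τ (fun i => X i ω) = structuralDim H P} : Set Ω) ≤ᵐ[Pr]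
      ((⋃ j, badSeg j) ∪ badOff : Set Ω) := by
    filter_upwards [ae_all_iff.2 hφ] with ω hω hne
    by_contra hgood
    have hgood' : ω ∉ (⋃ j, badSeg j) ∪ badOff := hgood
    simp only [Set.mem_union, Set.mem_iUnion, not_or, not_exists, hbadSeg, hbadOff,
      Set.mem_ofPred_eq, not_le] at hgood'
    obtain ⟨h1, h2⟩ := hgood'
    refine hne (qHat_eq_of_quadForm (deviationSubspace H P) hq hc hε0 hε1 hτ hτ0 hδ hcδ hεδ
      (fun f => 1 / n * centeredSS Finset.univ (fun i => ⟪meanElement H (P (seg i)), f⟫_ℝ))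
      (fun f => ?_) (fun f => ?_) (fun f hf => ?_) (fun f hf => ?_))
    · refine (abs_quadForm_sub_le ha hr (fun i => featureMap H (X i ω)) seg
        (fun j => meanElement H (P j)) hω hμb bad
        (fun m hm i hi k hk => segment_eq_of_notMem_image hr hz_mono hseg m hm hi hk) f).trans ?_
      refine mul_le_mul_of_nonneg_right (le_trans ?_ htc) (sq_nonneg _)
      have h3 : ∑ j, ‖segmentMean seg
          (fun i => featureMap H (X i ω) - meanElement H (P (seg i))) j‖ ≤ (s + 1) * t := by
        refine (Finset.sum_le_sum fun j _ => (h1 j).le).trans (le_of_eq ?_)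
        simp
      calc _ ≤ 6 * b * ((s + 1) * t) + t + (8 + 16 * (s + 2)) * b ^ 2 * (a / n : ℝ) := by
            gcongr
        _ = _ := by ring
    · exact mul_nonneg (by positivity) (centeredSS_nonneg _ _)
    · refine le_trans ?_ (le_centeredSS_of_card_le seg (fun j => meanElement H (P j)) hκ
        (fun j => (hweight j).trans (le_card_segment hz_mono hz_last hseg j)) hn f)
      rw [Fintype.card_fin, Nat.cast_add, Nat.cast_one]
      calc 2 * δ * ‖f‖ ^ 2 ≤ κ / (4 * (s + 1)) * δ₀ * ‖f‖ ^ 2 := by gcongr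
        _ = κ / (4 * (s + 1)) * (δ₀ * ‖f‖ ^ 2) := by ring
        _ ≤ _ := by gcongr; exact hδ₀ f hf
    · rw [centeredSS_eq_zero_of_mem_orthogonal seg (fun j => meanElement H (P j)) hf, mul_zero]
  have hreal : ∀ S : Set Ω, Pr S = ENNReal.ofReal (Pr.real S) := fun S => (ofReal_measureReal).symm
  refine (measure_mono_ae hsub).trans ?_
  rw [hreal]
  refine ENNReal.ofReal_le_ofReal ?_
  refine (measureReal_union_le _ _).trans ?_
  have h1 : Pr.real (⋃ j, badSeg j) ≤ ∑ _j : Fin (s + 1), (2 * b) ^ 2 * (1 / n) / t ^ 2 :=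
    (measureReal_iUnion_fintype_le _).trans (Finset.sum_le_sum fun j _ =>
      measureReal_norm_segmentMean_ge_le seg j hn hK hX hindep hmean' hcent ht)
  have h2 : Pr.real badOff ≤ (2 * b) ^ 4 * (16 / n) / t ^ 2 :=
    measureReal_norm_offDiagonal_ge_le ha hr hK hX hindep hmean' hcent ht
  refine (add_le_add h1 h2).trans (le_of_eq ?_)
  simp only [Finset.sum_const, Finset.card_univ, Fintype.card_fin, nsmul_eq_mul, Nat.cast_add,
    Nat.cast_one]
  ring

end Probability

/-! ### The tuning sequences -/

theorem etaTilde_pos {α : ℕ → ℕ} {n : ℕ} (hn : 0 < n) : 0 < etaTilde α n := by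
  have hn0 : (0 : ℝ) < n := by exact_mod_cast hn
  exact lt_max_of_lt_left (Real.sqrt_pos.2 (by positivity))

theorem one_div_le_etaTilde_sq (α : ℕ → ℕ) (n : ℕ) : 1 / (n : ℝ) ≤ etaTilde α n ^ 2 := by
  have h0 : (0 : ℝ) ≤ 1 / n := by positivity
  calc 1 / (n : ℝ) = Real.sqrt (1 / n) ^ 2 := (Real.sq_sqrt h0).symm
    _ ≤ etaTilde α n ^ 2 := by
      gcongr
      exact le_max_left _ _

theorem div_le_etaTilde (α : ℕ → ℕ) (n : ℕ) : (α n : ℝ) / n ≤ etaTilde α n := le_max_right _ _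

end CKPCA

end
/-- Consistency of the thresholding ridge ratio estimator of the structural dimension.

For each sample size `n` the observations `X n 0, …, X n (n - 1)` are independent; the segment
`z n j ≤ i < z n (j + 1)` (`j = 0, …, s`) of observations has the law `P j`, and its relative length
converges to `w j > 0`, so that for large `n` there are exactly `s` change points
`z n 1 < ⋯ < z n s`. -/
theorem theorem4
    {𝓧 : Type*} [MeasurableSpace 𝓧]
    (H : Type*) [NormedAddCommGroup H] [InnerProductSpace ℝ H] [CompleteSpace H] [RKHS ℝ H 𝓧 ℝ]
    (hK : Measurable fun p : 𝓧 × 𝓧 => CKPCA.kernelFun H p.1 p.2)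
    -- the segment distributions and their limiting weights
    {s : ℕ} (P : Fin (s + 1) → Measure 𝓧) [∀ j, IsProbabilityMeasure (P j)]
    (hP : ∀ j : Fin s, P j.castSucc ≠ P j.succ)
    (w : Fin (s + 1) → ℝ) (hw : ∀ j, 0 < w j)
    -- boundedness of the kernel along the data
    (B : ℝ) (hB : ∀ j, ∀ᵐ x ∂(P j), CKPCA.kernelFun H x x ≤ B)
    -- the change points
    (z : ℕ → Fin (s + 2) → ℕ) (hz_mono : ∀ n, Monotone (z n))
    (hz_zero : ∀ n, z n 0 = 0) (hz_last : ∀ n, z n (Fin.last (s + 1)) = n)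
    (hz_weight : ∀ j : Fin (s + 1),
      Tendsto (fun n : ℕ => ((z n j.succ : ℝ) - (z n j.castSucc : ℝ)) / (n : ℝ)) atTop (𝓝 (w j)))
    -- the observations
    {Ω : ℕ → Type*} [∀ n, MeasurableSpace (Ω n)]
    (Pr : ∀ n, Measure (Ω n)) [∀ n, IsProbabilityMeasure (Pr n)]
    (X : ∀ n, Fin n → Ω n → 𝓧) (hX : ∀ n i, Measurable (X n i))
    (hX_indep : ∀ n, iIndepFun (X n) (Pr n))
    (hX_law : ∀ n (i : Fin n) (j : Fin (s + 1)),
      z n j.castSucc ≤ i.val → i.val < z n j.succ → (Pr n).map (X n i) = P j)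
    -- the tuning parameters
    (α : ℕ → ℕ) (hα : ∀ᶠ n in atTop, 2 ≤ α n)
    (c : ℕ → ℝ) (hc : Tendsto c atTop (𝓝 0))
    (hη : Tendsto (CKPCA.etaTilde α) atTop (𝓝 0))
    (hcη : Tendsto (fun n => c n / CKPCA.etaTilde α n) atTop atTop)
    (τ : ℝ) (hτ0 : 0 < τ) (hτ1 : τ < 1) :
    Tendsto
      (fun n => Pr n {ω | CKPCA.qHat H (α n) (c n) τ (fun i => X n i ω) = CKPCA.structuralDim H P})
      atTop (𝓝 1) := by
  have hμ : ∃ δ₀ > 0, ∀ f ∈ CKPCA.deviationSubspace H P,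
      δ₀ * ‖f‖ ^ 2 ≤ ∑ p : Fin (s + 1) × Fin (s + 1),
        ⟪CKPCA.meanElement H (P p.1) - CKPCA.meanElement H (P p.2), f⟫_ℝ ^ 2 :=
    CKPCA.exists_pos_mul_norm_sq_le_sum_inner_sq _
  obtain ⟨δ₀, hδ₀, hδ₀D⟩ := hμ
  obtain ⟨j₀, hj₀⟩ := Finite.exists_min w
  -- Half of the smallest limiting weight is eventually a lower bound for every relative segment
  -- length.
  set κ : ℝ := w j₀ / 2 with hκdef
  have hκ : 0 < κ := half_pos (hw j₀)
  set δ : ℝ := κ / (4 * (s + 1)) * δ₀ / 2 with hδdef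
  have hδ : 0 < δ := by positivity
  set b : ℝ := Real.sqrt B
  have hb : 0 ≤ b := Real.sqrt_nonneg B
  -- Half of the largest value allowed by `τ * (1 + ε) ≤ 1 - ε`, so that the inequality is strict.
  set ε : ℝ := (1 - τ) / (2 * (1 + τ)) with hεdef
  have hε0 : 0 < ε := div_pos (by linarith) (by linarith)
  have hετ : ε * (2 * (1 + τ)) = 1 - τ := div_mul_cancel₀ _ (by positivity)
  have hε1 : ε < 1 := by nlinarith
  have hτε : τ * (1 + ε) < 1 - ε := by nlinarith
  -- The error budget `ε c_n` is split evenly: random terms below `θ c_n` use one half, and the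
  -- block-length remainder uses the other.
  set θ : ℝ := ε / (2 * (6 * b * (s + 1) + 1)) with hθdef
  have hθ : 0 < θ := by positivity
  have hθε : (6 * b * (s + 1) + 1) * θ = ε / 2 := by
    rw [hθdef]
    field_simp
  set C : ℝ := (8 + 16 * (s + 2)) * b ^ 2 with hCdef
  have hC : 0 ≤ C := by positivity
  set K : ℝ := (s + 1) * (2 * b) ^ 2 + 16 * (2 * b) ^ 4 with hKdef
  have hK0 : 0 ≤ K := by positivity
  have hweight : ∀ᶠ n : ℕ in atTop, ∀ j : Fin (s + 1),
      κ < ((z n j.succ : ℝ) - (z n j.castSucc : ℝ)) / (n : ℝ) :=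
    eventually_all.2 fun j => (hz_weight j).eventually_const_lt (by
      have := hj₀ j; have := hw j₀; rw [hκdef]; linarith)
  have hbound : ∀ᶠ n : ℕ in atTop,
      Pr n {ω | ¬ CKPCA.qHat H (α n) (c n) τ (fun i => X n i ω) = CKPCA.structuralDim H P} ≤
        ENNReal.ofReal (K * (θ ^ 2)⁻¹ * ((c n / CKPCA.etaTilde α n) ^ 2)⁻¹) := by
    filter_upwards [hweight, hα, hη.eventually_lt_const one_pos, hcη.eventually_ge_atTop 1,
      hcη.eventually_ge_atTop (2 * C / ε), hc.eventually_lt_const (u := τ * δ / 2) (by positivity),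
      hc.eventually_lt_const (u := δ) hδ,
      eventually_ge_atTop (CKPCA.structuralDim H P + 1)] with n hwn han hηn hc1 hcC hcτ hcδ hn
    have hn0 : 0 < n := by omega
    have hnR : (0 : ℝ) < n := by exact_mod_cast hn0
    have hηpos := CKPCA.etaTilde_pos (α := α) hn0
    have hαη := CKPCA.div_le_etaTilde α n
    have hcη' : CKPCA.etaTilde α n ≤ c n := by rwa [le_div_iff₀ hηpos, one_mul] at hc1
    have hcpos : 0 < c n := hηpos.trans_le hcη'
    -- Since `α n / n ≤ etaTilde α n < 1`, there is at least one block.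
    have hr : 0 < n / α n := by
      refine Nat.div_pos ?_ (by omega)
      have h := hαη.trans hηn.le
      rw [div_le_one hnR] at h
      exact_mod_cast h
    have hCα : C * ((α n : ℝ) / n) ≤ ε / 2 * c n := by
      rw [le_div_iff₀ hηpos, div_mul_eq_mul_div, div_le_iff₀ hε0] at hcC
      have := mul_le_mul_of_nonneg_left hαη hC
      linarith
    refine (CKPCA.measure_qHat_ne_le (t := θ * c n) hK P hB (hz_mono n) (hz_zero n) (hz_last n)
      (hX n) (hX_indep n) (hX_law n) han hr hκ.le
      (fun j => (le_div_iff₀ hnR).1 (hwn j).le) hδ₀D (by linarith) hn hcpos hε0.le hε1 hτε hτ0 hδ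
      (by nlinarith) (by nlinarith) (by positivity) ?_).trans ?_
    · rw [← mul_assoc, hθε]
      linarith
    · refine ENNReal.ofReal_le_ofReal ?_
      rw [mul_assoc K]
      refine mul_le_mul_of_nonneg_left ?_ hK0
      have hsplit : 1 / (n : ℝ) / (θ * c n) ^ 2 = (θ ^ 2)⁻¹ * (1 / n / c n ^ 2) := by
        rw [mul_pow, div_mul_eq_div_div_swap, inv_mul_eq_div]
      rw [hsplit, div_pow (c n), inv_div (c n ^ 2)]
      gcongr
      exact CKPCA.one_div_le_etaTilde_sq α n
  have hlim : Tendsto (fun n => ENNReal.ofReal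
      (K * (θ ^ 2)⁻¹ * ((c n / CKPCA.etaTilde α n) ^ 2)⁻¹)) atTop (𝓝 0) := by
    rw [← ENNReal.ofReal_zero]
    refine ENNReal.tendsto_ofReal ?_
    have h := ((tendsto_pow_atTop two_ne_zero).comp hcη).inv_tendsto_atTop.const_mul
      (K * (θ ^ 2)⁻¹)
    rw [mul_zero] at h
    exact h
  have hone := ENNReal.Tendsto.sub (tendsto_const_nhds (x := (1 : ENNReal))) hlim
    (Or.inl ENNReal.one_ne_top)
  rw [tsub_zero] at hone
  refine tendsto_of_tendsto_of_tendsto_of_le_of_le' hone tendsto_const_nhds ?_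
    (Eventually.of_forall fun n => prob_le_one)
  filter_upwards [hbound] with n hn
  rw [tsub_le_iff_right]
  -- Passing to the complement by subadditivity avoids having to prove that the event is measurable.
  calc (1 : ENNReal) = Pr n Set.univ := measure_univ.symm
    _ ≤ Pr n ({ω | CKPCA.qHat H (α n) (c n) τ (fun i => X n i ω) = CKPCA.structuralDim H P} ∪
        {ω | ¬ CKPCA.qHat H (α n) (c n) τ (fun i => X n i ω) = CKPCA.structuralDim H P}) :=
      measure_mono fun ω _ => em _
    _ ≤ _ := (measure_union_le _ _).trans (by gcongr)
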